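/- Let $q\ge 2$ and let $\pi_1(\Sigma)=\langle a_1,b_1,\dots,a_q,b_q \mid [a_1,b_1][a_2,b_2]\cdots[a_q,b_q]=1\rangle$ be the fundamental group of the closed orientable surface $\Sigma$ of genus $q$. Let $\mathrm{Homeo}_+(\mathbb{R})$ be the group of orientation-preserving homeomorphisms of $\mathbb{R}$ with the compact-open topology, and let $\mathrm{Rep}(\pi_1(\Sigma),\mathrm{Homeo}_+(\mathbb{R}))$ be the set of all group homomorphisms $\rho:\pi_1(\Sigma)\to\mathrm{Homeo}_+(\mathbb{R})$ with the topology of pointwise convergence (so $\rho_n\to\rho$ if and only if, for every $g\in\pi_1(\Sigma)$, $\rho_n(g)\to\rho(g)$ uniformly on compact subsets of $\mathbb{R}$). Then there is a representation $\rho\in\mathrm{Rep}(\pi_1(\Sigma),\mathrm{Homeo}_+(\mathbb{R}))$ without global fixed points (that is, there is no $x\in\mathbb{R}$ with $\rho(g)(x)=x$ for all $g\in\pi_1(\Sigma)$) whose conjugacy class $\{h\rho(\cdot)h^{-1} : h\in\mathrm{Homeo}_+(\mathbb{R})\}$ is dense in $\mathrm{Rep}(\pi_1(\Sigma),\mathrm{Homeo}_+(\mathbb{R}))$.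 -/

import Mathlib

/-- `Homeo₊(ℝ)`: the group, under composition, of orientation-preserving (that is, strictly
increasing) homeomorphisms of the real line. -/
def HomeoPlus : Subgroup (ℝ ≃ₜ ℝ) where
  carrier := {f | StrictMono f}
  mul_mem' := by
    intro f g hf hg x y hxy
    exact hf (hg hxy)
  one_mem' := strictMono_id
  inv_mem' := by
    intro f hf x y hxy
    have hf' : StrictMono f := hf
    change f.symm x < f.symm y
    rw [← hf'.lt_iff_lt]
    simpa using hxy

/-- The compact-open topology on `Homeo₊(ℝ)`, i.e. uniform convergence on compact sets. -/
instance HomeoPlus.instTopologicalSpace : TopologicalSpace HomeoPlus :=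
  TopologicalSpace.induced (fun f : HomeoPlus => (⟨f.1, f.1.continuous⟩ : C(ℝ, ℝ)))
    ContinuousMap.compactOpen

/-- `Rep(Γ, Homeo₊(ℝ))`: all group homomorphisms from `Γ` to `Homeo₊(ℝ)`. -/
abbrev LineRep (Γ : Type*) [Group Γ] : Type _ := Γ →* HomeoPlus

namespace LineRep

variable {Γ : Type*} [Group Γ]

/-- The topology of pointwise convergence on `Rep(Γ, Homeo₊(ℝ))`, i.e. the one induced from the
product topology on functions `Γ → Homeo₊(ℝ)`. -/
instance instTopologicalSpace : TopologicalSpace (LineRep Γ) :=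
  TopologicalSpace.induced (fun ρ : LineRep Γ => (fun g => ρ g : Γ → HomeoPlus))
    Pi.topologicalSpace

/-- The set of global fixed points of a representation. -/
def globalFix (ρ : LineRep Γ) : Set ℝ := {x | ∀ g : Γ, (ρ g).1 x = x}

/-- The conjugate representation `g ↦ h ∘ ρ(g) ∘ h⁻¹`. -/
def conj (h : HomeoPlus) (ρ : LineRep Γ) : LineRep Γ := (MulAut.conj h).toMonoidHom.comp ρ

/-- The conjugacy class of a representation under `Homeo₊(ℝ)`. -/
def conjClass (ρ : LineRep Γ) : Set (LineRep Γ) := Set.range fun h : HomeoPlus => conj h ρ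

end LineRep

/-- The relator `[a₁,b₁][a₂,b₂]⋯[a_q,b_q]`, where `aᵢ` is the generator `Sum.inl i`, `bᵢ` is
the generator `Sum.inr i`, and `[a,b] = a b a⁻¹ b⁻¹`. -/
def surfaceRelator (q : ℕ) : FreeGroup (Fin q ⊕ Fin q) :=
  (List.ofFn fun i : Fin q =>
    FreeGroup.of (Sum.inl i) * FreeGroup.of (Sum.inr i) *
      (FreeGroup.of (Sum.inl i))⁻¹ * (FreeGroup.of (Sum.inr i))⁻¹).prod

/-- The surface group `π₁(Σ_q) = ⟨a₁, b₁, …, a_q, b_q ∣ [a₁,b₁]⋯[a_q,b_q] = 1⟩` of the closed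
orientable surface `Σ_q` of genus `q`. -/
abbrev SurfaceGroup (q : ℕ) : Type := PresentedGroup {surfaceRelator q}

/-! A dense conjugacy class is produced by placing countably many actions side by side on one line.
Call an action standard if it has no global fixed point and, near both ends of the line, each
generator acts by a fixed translation, the same for all standard actions. Any sequence of standard
actions can be concatenated (`exists_concatenation`): consecutive blocks overlap where both act by
the same translations, so the relation survives and no global fixed point appears. The space of
representations is second countable, so a countable dense family of standard actions exists if
standard actions are dense. Placing each member infinitely often, with larger and larger faithful
windows, and conjugating by translations that recentre these windows, recovers every member in the
limit.

What remains is the density of standard actions (`SurfaceGroup.dense_standardReps`), in two stages.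

An action without global fixed points is made standard outside a compact set (`exists_standard`). At
one end, all handles but the first are truncated to be trivial near infinity. The first pair is
altered to follow the resulting change of its commutator without new common fixed points
(`commutatorExtendsPast`). It is then truncated in turn, and the second handle absorbs the error
while becoming a translation at infinity; genus at least 2 enters here. The mechanism throughout is
that ⁅h, f⁆ = V says that h conjugates f to V f, and increasing homeomorphisms moving all points in
the same direction are conjugate.

An arbitrary action is approximated by actions without global fixed points
(`exists_no_fixed_point_near`): it is cut at global fixed points, the pieces are approximated
separately, and these are reassembled by concatenation. -/

open Filter Topology Set
open scoped commutatorElement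

/-! ### Gluing and conjugating increasing homeomorphisms of the line -/

namespace OrderIso

theorem exists_coe_eq_of_continuous {f : ℝ → ℝ} (hm : StrictMono f) (hc : Continuous f)
    (ht : Tendsto f atTop atTop) (hb : Tendsto f atBot atBot) :
    ∃ e : ℝ ≃o ℝ, ∀ x, e x = f x :=
  ⟨hm.orderIsoOfSurjective f (hc.surjective ht hb), fun _ => rfl⟩

theorem exists_glue (f g : ℝ ≃o ℝ) {p : ℝ} (h : f p = g p) :
    ∃ e : ℝ ≃o ℝ, (∀ x ≤ p, e x = f x) ∧ ∀ x, p ≤ x → e x = g x := by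
  classical
  have hm : StrictMono fun x => if x ≤ p then f x else g x := by
    intro x y hxy
    dsimp only
    split_ifs with h1 h2 h2
    · exact f.strictMono hxy
    · exact (f.monotone h1).trans_lt (h ▸ g.strictMono (not_le.1 h2))
    · exact absurd (hxy.le.trans h2) h1
    · exact g.strictMono hxy
  have hs : Function.Surjective fun x => if x ≤ p then f x else g x := by
    intro y
    rcases le_or_gt y (f p) with hy | hy
    · refine ⟨f.symm y, ?_⟩
      have : f.symm y ≤ p := by rwa [f.symm_apply_le]
      simp [this]
    · refine ⟨g.symm y, ?_⟩
      have : ¬ g.symm y ≤ p := by rw [g.symm_apply_le, ← h]; exact not_le.2 hy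
      simp [this]
  refine ⟨hm.orderIsoOfSurjective _ hs, fun x hx => ?_, fun x hx => ?_⟩
  · simp [hx]
  · rcases hx.eq_or_lt with rfl | hx
    · simp [h]
    · simp [not_le.2 hx]

theorem exists_affine {s : ℝ} (hs : 0 < s) (t : ℝ) : ∃ e : ℝ ≃o ℝ, ∀ x, e x = s * x + t := by
  refine exists_coe_eq_of_continuous (f := fun x => s * x + t) ?_ (by fun_prop) ?_ ?_
  · intro x y hxy
    simpa using mul_lt_mul_of_pos_left hxy hs
  · exact tendsto_atTop_add_const_right _ _ (tendsto_id.const_mul_atTop hs)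
  · exact tendsto_atBot_add_const_right _ _ (tendsto_id.const_mul_atBot hs)

theorem exists_affine_through {x₀ y₀ x₁ y₁ : ℝ} (hx : x₀ < x₁) (hy : y₀ < y₁) :
    ∃ e : ℝ ≃o ℝ, e x₀ = y₀ ∧ e x₁ = y₁ := by
  have h : 0 < (y₁ - y₀) / (x₁ - x₀) := div_pos (by linarith) (by linarith)
  obtain ⟨e, he⟩ := exists_affine h (y₀ - (y₁ - y₀) / (x₁ - x₀) * x₀)
  have h' : x₁ - x₀ ≠ 0 := by linarith
  refine ⟨e, by rw [he]; ring, ?_⟩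
  rw [he]
  field_simp
  ring

/-- Given two increasing homeomorphisms with compatible order of endpoints, some increasing
homeomorphism agrees with the first on the left and with the second on the right. -/
theorem exists_interpolate (f g : ℝ ≃o ℝ) {p q : ℝ} (hpq : p < q) (h : f p < g q) :
    ∃ e : ℝ ≃o ℝ, (∀ x ≤ p, e x = f x) ∧ ∀ x, q ≤ x → e x = g x := by
  obtain ⟨l, hl, hl'⟩ := exists_affine_through hpq h
  obtain ⟨e₁, h₁, h₁'⟩ := exists_glue f l hl.symm
  obtain ⟨e, h₂, h₂'⟩ := exists_glue e₁ g (p := q) (by rw [h₁' q hpq.le, hl'])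
  exact ⟨e, fun x hx => by rw [h₂ x (hx.trans hpq.le), h₁ x hx], h₂'⟩

theorem exists_eventually_id (f : ℝ ≃o ℝ) (R : ℝ) :
    ∃ e : ℝ ≃o ℝ, (∀ x ≤ R, e x = f x) ∧ ∀ᶠ x in atTop, e x = x := by
  obtain ⟨e, h, h'⟩ := exists_interpolate f (OrderIso.refl ℝ) (p := R) (q := max R (f R) + 1)
    (by linarith [le_max_left R (f R)])
    (by simp only [refl_apply]; linarith [le_max_right R (f R)])
  exact ⟨e, h, eventually_atTop.2 ⟨_, h'⟩⟩

/-- An orbit staying above Y would decrease to a limit, which by continuity would be a fixed point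
of f in [Y, ∞). -/
theorem exists_iterate_le (f : ℝ ≃o ℝ) {Y : ℝ} (hf : ∀ x, Y ≤ x → f x < x) (x : ℝ) :
    ∃ n : ℕ, (f ^ n) x ≤ Y := by
  by_contra! hn
  have hs : ∀ n : ℕ, (f ^ (n + 1)) x = f ((f ^ n) x) := fun n => by rw [pow_succ']; rfl
  have ha : Antitone fun n : ℕ => (f ^ n) x :=
    antitone_nat_of_succ_le fun n => by rw [hs]; exact (hf _ (hn n).le).le
  have hb : BddBelow (range fun n : ℕ => (f ^ n) x) :=
    ⟨Y, by rintro _ ⟨n, rfl⟩; exact (hn n).le⟩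
  have hl := tendsto_atTop_ciInf ha hb
  have hl' := (hl.comp (tendsto_add_atTop_nat 1))
  have hl'' := (f.continuous.tendsto _).comp hl
  have heq := tendsto_nhds_unique (hl'.congr fun n => hs n) hl''
  exact (hf _ (le_ciInf fun n => (hn n).le)).ne heq.symm

theorem exists_le_iterate (f : ℝ ≃o ℝ) {p : ℝ} (hf : ∀ x, p < x → x < f x) {x : ℝ} (hx : p < x)
    (Q : ℝ) : ∃ n : ℕ, Q ≤ (f ^ n) x := by
  by_contra! hn
  have hs : ∀ n : ℕ, (f ^ (n + 1)) x = f ((f ^ n) x) := fun n => by rw [pow_succ']; rfl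
  have hp : ∀ n : ℕ, x ≤ (f ^ n) x := by
    intro n
    induction n with
    | zero => exact le_rfl
    | succ n ih => rw [hs]; exact ih.trans (hf _ (hx.trans_le ih)).le
  have ha : Monotone fun n : ℕ => (f ^ n) x :=
    monotone_nat_of_le_succ fun n => by rw [hs]; exact (hf _ (hx.trans_le (hp n))).le
  have hb : BddAbove (range fun n : ℕ => (f ^ n) x) :=
    ⟨Q, by rintro _ ⟨n, rfl⟩; exact (hn n).le⟩
  have hl := tendsto_atTop_ciSup ha hb
  have hl' := (hl.comp (tendsto_add_atTop_nat 1))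
  have hl'' := (f.continuous.tendsto _).comp hl
  have heq := tendsto_nhds_unique (hl'.congr fun n => hs n) hl''
  exact (hf _ (hx.trans_le (le_ciSup hb 0))).ne heq

/-- If `k` conjugates `f` to `g` on a forward invariant set which every orbit enters, then `k`
restricted to this set extends to a global conjugacy `lim g⁻ⁿ k fⁿ`. -/
theorem exists_conj_of_eventually (f g k : ℝ ≃o ℝ) (D : Set ℝ) (hD : ∀ x ∈ D, f x ∈ D)
    (hk : ∀ x ∈ D, k (f x) = g (k x)) (hf : ∀ x, ∃ n : ℕ, (f ^ n) x ∈ D)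
    (hg : ∀ y, ∃ n : ℕ, ∃ z ∈ D, (g ^ n) y = k z) :
    ∃ h : ℝ ≃o ℝ, (∀ x ∈ D, h x = k x) ∧ ∀ x, h (f x) = g (h x) := by
  have hinv : ∀ n : ℕ, ∀ x ∈ D, (f ^ n) x ∈ D ∧ k ((f ^ n) x) = (g ^ n) (k x) := by
    intro n x hx
    induction n with
    | zero => exact ⟨hx, rfl⟩
    | succ n ih =>
      rw [pow_succ', pow_succ', RelIso.mul_apply, RelIso.mul_apply]
      exact ⟨hD _ ih.1, by rw [hk _ ih.1, ih.2]⟩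
  choose N hN using hf
  have hmem : ∀ x n, N x ≤ n → (f ^ n) x ∈ D := by
    intro x n hn
    obtain ⟨m, rfl⟩ := Nat.exists_eq_add_of_le hn
    rw [add_comm, pow_add, RelIso.mul_apply]
    exact (hinv m _ (hN x)).1
  -- The sequence g⁻ⁿ k fⁿ x is constant once fⁿ x lies in D (this is `hh`), so any such exponent
  -- gives the limit.
  let h : ℝ → ℝ := fun x => (g ^ N x).symm (k ((f ^ N x) x))
  have hh : ∀ x n, (f ^ n) x ∈ D → (g ^ n) (h x) = k ((f ^ n) x) := by
    intro x n hn
    rcases le_total n (N x) with hle | hle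
    · obtain ⟨m, hm⟩ := Nat.exists_eq_add_of_le hle
      have e1 : (g ^ N x) (h x) = k ((f ^ N x) x) := (g ^ N x).apply_symm_apply _
      rw [hm, add_comm, pow_add, pow_add, RelIso.mul_apply, RelIso.mul_apply,
        (hinv m _ hn).2] at e1
      exact (g ^ m).injective e1
    · obtain ⟨m, rfl⟩ := Nat.exists_eq_add_of_le hle
      rw [add_comm, pow_add, pow_add, RelIso.mul_apply, RelIso.mul_apply, (hinv m _ (hN x)).2]
      congr 1
      exact (g ^ N x).apply_symm_apply _
  have hm : StrictMono h := by
    intro x y hxy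
    have h1 := hh x _ (hmem x (max (N x) (N y)) (le_max_left _ _))
    have h2 := hh y _ (hmem y (max (N x) (N y)) (le_max_right _ _))
    rw [← (g ^ max (N x) (N y)).lt_iff_lt, h1, h2]
    simpa using hxy
  have hs : Function.Surjective h := by
    intro y
    obtain ⟨n, z, hz, hy⟩ := hg y
    refine ⟨(f ^ n).symm z, ?_⟩
    have h1 : (f ^ n) ((f ^ n).symm z) = z := (f ^ n).apply_symm_apply z
    apply (g ^ n).injective
    rw [hh _ n (by rwa [h1]), h1, hy]
  refine ⟨hm.orderIsoOfSurjective h hs, fun x hx => hh x 0 hx, fun x => ?_⟩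
  change h (f x) = g (h x)
  have h1 : (f ^ (N x + 1)) x ∈ D := hmem x _ (by lia)
  have h2 := hh x _ h1
  rw [pow_succ, RelIso.mul_apply] at h1
  have h3 := hh (f x) _ h1
  rw [pow_succ, pow_succ, RelIso.mul_apply, RelIso.mul_apply, ← h3] at h2
  exact ((g ^ N x).injective h2).symm

end OrderIso

/-! ### Commutators with prescribed value -/

/-- The increasing homeomorphisms of the line with trivial germ at `+∞`. -/
def trivialGermAtTop : Subgroup (ℝ ≃o ℝ) where
  carrier := {f | ∀ᶠ x in atTop, f x = x}
  mul_mem' := by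
    intro f g hf hg
    filter_upwards [hf, hg] with x hx hy
    rw [RelIso.mul_apply, hy, hx]
  one_mem' := Eventually.of_forall fun _ => rfl
  inv_mem' := by
    intro f hf
    filter_upwards [hf] with x hx
    rw [← f.injective.eq_iff, RelIso.apply_inv_self, hx]

theorem mem_trivialGermAtTop {f : ℝ ≃o ℝ} :
    f ∈ trivialGermAtTop ↔ ∀ᶠ x in atTop, f x = x := Iff.rfl

theorem commutatorElement_eq_iff {G : Type*} [Group G] {a b v : G} :
    ⁅a, b⁆ = v ↔ a * b = v * b * a := by
  rw [commutatorElement_def, mul_inv_eq_iff_eq_mul, mul_inv_eq_iff_eq_mul]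

theorem commutatorElement_eq_iff_apply {a b v : ℝ ≃o ℝ} :
    ⁅a, b⁆ = v ↔ ∀ x, a (b x) = v (b (a x)) := by
  rw [commutatorElement_eq_iff]
  exact DFunLike.ext_iff

theorem inv_apply_eq_self {f : ℝ ≃o ℝ} {x : ℝ} : f⁻¹ x = x ↔ f x = x := by
  rw [← f.injective.eq_iff, RelIso.apply_inv_self, eq_comm]

theorem inv_apply_lt {f : ℝ ≃o ℝ} {x y : ℝ} : f⁻¹ x < y ↔ x < f y := by
  rw [← f.lt_iff_lt, RelIso.apply_inv_self]

theorem lt_inv_apply {f : ℝ ≃o ℝ} {x y : ℝ} : x < f⁻¹ y ↔ f x < y := by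
  rw [← f.lt_iff_lt, RelIso.apply_inv_self]

theorem inv_apply_le {f : ℝ ≃o ℝ} {x y : ℝ} : f⁻¹ x ≤ y ↔ x ≤ f y := by
  rw [← f.le_iff_le, RelIso.apply_inv_self]

/-- A homeomorphism supported on a bounded part of `[P, ∞)` is the commutator of two
homeomorphisms supported on `[P, ∞)`, the second one without fixed points there. -/
theorem exists_commutator_eq {P : ℝ} {V : ℝ ≃o ℝ} (hP : ∀ x ≤ P, V x = x)
    (hV : V ∈ trivialGermAtTop) :
    ∃ h f : ℝ ≃o ℝ, (∀ x ≤ P, h x = x) ∧ (∀ x ≤ P, f x = x) ∧ ⁅h, f⁆ = V ∧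
      (∀ x, P < x → x < f x) ∧ h ∈ trivialGermAtTop ∧ ∀ᶠ x in atTop, f x = x + 1 := by
  obtain ⟨Q₀, hQ₀⟩ := eventually_atTop.1 (mem_trivialGermAtTop.1 hV)
  obtain ⟨Q, hQQ, hQP⟩ : ∃ Q, Q₀ ≤ Q ∧ P + 1 ≤ Q := ⟨_, le_max_left Q₀ (P + 1), le_max_right _ _⟩
  have hQ : ∀ x, Q ≤ x → V x = x := fun x hx => hQ₀ x (hQQ.trans hx)
  -- The maximum with V⁻¹ x and the bump, positive exactly on (P, ∞), make both f and V f move every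
  -- point beyond P to the right.
  obtain ⟨f, hf⟩ := OrderIso.exists_coe_eq_of_continuous
    (f := fun x => max x (V⁻¹ x) + max 0 (min (x - P) 1)) (by
      intro x y hxy
      have h1 : max x (V⁻¹ x) < max y (V⁻¹ y) := max_lt_max hxy (V⁻¹.strictMono hxy)
      have h2 : max 0 (min (x - P) 1) ≤ max 0 (min (y - P) 1) := by gcongr
      dsimp only
      linarith) (by
      have := (V⁻¹).continuous
      fun_prop) (by
      refine tendsto_atTop_mono (fun x => ?_) tendsto_id
      have h1 := le_max_left x (V⁻¹ x)
      have h2 := le_max_left 0 (min (x - P) 1)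
      dsimp only [id]
      linarith) (by
      refine tendsto_id.congr' ?_
      filter_upwards [eventually_le_atBot P] with x hx
      have h1 : V⁻¹ x = x := inv_apply_eq_self.2 (hP x hx)
      have h2 : max 0 (min (x - P) 1) = 0 :=
        max_eq_left ((min_le_left _ _).trans (by linarith))
      rw [h1, h2, max_self]; simp)
  have hfP : ∀ x ≤ P, f x = x := by
    intro x hx
    have h1 : V⁻¹ x = x := inv_apply_eq_self.2 (hP x hx)
    have h2 : max 0 (min (x - P) 1) = 0 :=
      max_eq_left ((min_le_left _ _).trans (by linarith))
    rw [hf, h1, h2, max_self, add_zero]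
  have hpos : ∀ x, P < x → 0 < max 0 (min (x - P) 1) := fun x hx =>
    lt_max_of_lt_right (lt_min (by linarith) one_pos)
  have hfgt : ∀ x, P < x → x < f x := fun x hx => by
    rw [hf]
    linarith [le_max_left x (V⁻¹ x), hpos x hx]
  have hfgt' : ∀ x, P < x → x < V (f x) := fun x hx => by
    rw [← inv_apply_lt, hf]
    linarith [le_max_right x (V⁻¹ x), hpos x hx]
  have hfQ : ∀ x, Q ≤ x → f x = x + 1 := fun x hx => by
    have h1 : V⁻¹ x = x := inv_apply_eq_self.2 (hQ x hx)
    have h2 : min (x - P) 1 = 1 := min_eq_right (by linarith)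
    rw [hf, h1, h2, max_self, max_eq_right zero_le_one]
  have hgQ : ∀ x, Q ≤ x → V (f x) = x + 1 := fun x hx => by
    rw [hfQ x hx, hQ _ (by linarith)]
  -- Since f and V f coincide on this set and their orbits enter it, the identity there extends to a
  -- conjugacy h from f to V f.
  obtain ⟨h, hD, hc⟩ := OrderIso.exists_conj_of_eventually f (V * f) 1 (Iic P ∪ Ici Q)
    (by
      rintro x (hx | hx)
      · left; rw [hfP x hx]; exact hx
      · right; rw [hfQ x hx]; exact (mem_Ici.1 hx).trans (by linarith))
    (by
      rintro x (hx | hx)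
      · simp only [RelIso.one_apply, RelIso.mul_apply]
        rw [hfP x hx, hP x hx]
      · simp only [RelIso.one_apply, RelIso.mul_apply]
        rw [hfQ x hx, hQ]
        linarith [mem_Ici.1 hx])
    (by
      intro x
      rcases le_or_gt x P with hx | hx
      · exact ⟨0, Or.inl hx⟩
      · obtain ⟨n, hn⟩ := OrderIso.exists_le_iterate f hfgt hx Q
        exact ⟨n, Or.inr hn⟩)
    (by
      intro x
      rcases le_or_gt x P with hx | hx
      · exact ⟨0, x, Or.inl hx, rfl⟩
      · obtain ⟨n, hn⟩ := OrderIso.exists_le_iterate (V * f) hfgt' hx Q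
        exact ⟨n, _, Or.inr hn, rfl⟩)
  refine ⟨h, f, fun x hx => hD x (Or.inl hx), hfP, ?_, hfgt, ?_, eventually_atTop.2 ⟨Q, hfQ⟩⟩
  · rw [commutatorElement_eq_iff_apply]
    exact hc
  · exact eventually_atTop.2 ⟨Q, fun x hx => hD x (Or.inr hx)⟩

/-- Rewrites ⁅h, f⁆ as ⁅h f h⁻¹, h⁻¹⁆ or as ⁅f⁻¹, f h f⁻¹⁆, so that the first entry is the
translation-like one, in either direction. Both signs are needed because the end −∞ is treated by
reflection. -/
theorem exists_commutator_eq_of_sign {P : ℝ} {V : ℝ ≃o ℝ} (hP : ∀ x ≤ P, V x = x)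
    (hV : V ∈ trivialGermAtTop) {ε : ℝ} (hε : ε = 1 ∨ ε = -1) :
    ∃ a b : ℝ ≃o ℝ, (∀ x ≤ P, a x = x) ∧ (∀ x ≤ P, b x = x) ∧ ⁅a, b⁆ = V ∧
      (∀ x, P < x → a x ≠ x) ∧ b ∈ trivialGermAtTop ∧ ∀ᶠ x in atTop, a x = x + ε := by
  obtain ⟨h, f, hh, hf, hc, hgt, hh', hf'⟩ := exists_commutator_eq hP hV
  have hinv : ∀ {g : ℝ ≃o ℝ}, (∀ x ≤ P, g x = x) → ∀ x ≤ P, g⁻¹ x = x :=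
    fun hg x hx => inv_apply_eq_self.2 (hg x hx)
  obtain ⟨Q, hQ⟩ := eventually_atTop.1 (mem_trivialGermAtTop.1 hh')
  obtain ⟨Q', hQ'⟩ := eventually_atTop.1 hf'
  rcases hε with rfl | rfl
  · refine ⟨h * f * h⁻¹, h⁻¹, fun x hx => ?_, hinv hh, ?_, fun x hx => ?_, inv_mem hh', ?_⟩
    · simp only [RelIso.mul_apply]
      rw [hinv hh x hx, hf x hx, hh x hx]
    · rw [← hc]; simp only [commutatorElement_def]; group
    · simp only [RelIso.mul_apply]
      rw [Ne, ← h⁻¹.injective.eq_iff, RelIso.inv_apply_self]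
      refine (hgt _ ?_).ne'
      rw [lt_inv_apply, hh P le_rfl]
      exact hx
    · filter_upwards [eventually_ge_atTop Q, eventually_ge_atTop Q', inv_mem hh'] with x h1 h2 h3
      simp only [RelIso.mul_apply]
      rw [h3, hQ' x h2, hQ]
      linarith
  · refine ⟨f⁻¹, f * h * f⁻¹, hinv hf, fun x hx => ?_, ?_, fun x hx => ?_, ?_, ?_⟩
    · simp only [RelIso.mul_apply]
      rw [hinv hf x hx, hh x hx, hf x hx]
    · rw [← hc]; simp only [commutatorElement_def]; group
    · rw [Ne, inv_apply_eq_self]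
      exact (hgt x hx).ne'
    · filter_upwards [eventually_ge_atTop (Q + 1), eventually_ge_atTop (Q' + 1)] with x h1 h2
      have h3 : f⁻¹ x = x + -1 := by
        rw [← f.injective.eq_iff, RelIso.apply_inv_self, hQ' _ (by linarith)]; ring
      simp only [RelIso.mul_apply]
      rw [h3, hQ _ (by linarith), hQ' _ (by linarith)]
      ring
    · filter_upwards [eventually_ge_atTop (Q' + 1)] with x h2
      rw [← f.injective.eq_iff, RelIso.apply_inv_self, hQ' _ (by linarith)]; ring

/-- Past a common fixed point, a pair with prescribed commutator can be made standard. -/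
theorem exists_commutator_eq_of_fixed {a b V : ℝ ≃o ℝ} {P : ℝ} (ha : a P = P) (hb : b P = P)
    (hP : ∀ x ≤ P, V x = ⁅a, b⁆ x) (hV : V ∈ trivialGermAtTop) {ε : ℝ} (hε : ε = 1 ∨ ε = -1) :
    ∃ a' b' : ℝ ≃o ℝ, (∀ x ≤ P, a' x = a x) ∧ (∀ x ≤ P, b' x = b x) ∧ ⁅a', b'⁆ = V ∧
      (∀ x, P < x → a' x ≠ x) ∧ b' ∈ trivialGermAtTop ∧ ∀ᶠ x in atTop, a' x = x + ε := by
  have hVP : V P = P := by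
    rw [hP P le_rfl]
    simp only [commutatorElement_def, RelIso.mul_apply]
    rw [inv_apply_eq_self.2 hb, inv_apply_eq_self.2 ha, hb, ha]
  -- To the left of the common fixed point P the given pair already works, so only the part of V to
  -- the right has to be realised.
  obtain ⟨V₀, h₀, h₀'⟩ := OrderIso.exists_glue 1 V (p := P) (by rw [hVP]; rfl)
  have hV₀ : V₀ ∈ trivialGermAtTop := by
    filter_upwards [hV, eventually_ge_atTop P] with x hx hx'
    rw [h₀' x hx', hx]
  obtain ⟨c, d, hc, hd, hcd, hne, hdt, hct⟩ := exists_commutator_eq_of_sign h₀ hV₀ hε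
  obtain ⟨a', ha1, ha2⟩ := OrderIso.exists_glue a c (p := P) (by rw [ha, hc P le_rfl])
  obtain ⟨b', hb1, hb2⟩ := OrderIso.exists_glue b d (p := P) (by rw [hb, hd P le_rfl])
  refine ⟨a', b', ha1, hb1, ?_, fun x hx => by rw [ha2 x hx.le]; exact hne x hx, ?_, ?_⟩
  · rw [commutatorElement_eq_iff_apply]
    intro x
    rcases le_total x P with hx | hx
    · have h1 : a x ≤ P := ha ▸ a.monotone hx
      have h2 : b x ≤ P := hb ▸ b.monotone hx
      have h3 : b (a x) ≤ P := hb ▸ b.monotone h1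
      rw [hb1 x hx, ha1 x hx, hb1 _ h1, ha1 _ h2, hP _ h3]
      simp [commutatorElement_def, RelIso.mul_apply]
    · have h1 : P ≤ c x := (hc P le_rfl).symm.le.trans (c.monotone hx)
      have h2 : P ≤ d x := (hd P le_rfl).symm.le.trans (d.monotone hx)
      have h3 : P ≤ d (c x) := (hd P le_rfl).symm.le.trans (d.monotone h1)
      rw [hb2 x hx, ha2 x hx, hb2 _ h1, ha2 _ h2, ← h₀' _ h3]
      exact commutatorElement_eq_iff_apply.1 hcd x
  · filter_upwards [hdt, eventually_ge_atTop P] with x hx hx'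
    rw [hb2 x hx', hx]
  · filter_upwards [hct, eventually_ge_atTop P] with x hx hx'
    rw [ha2 x hx', hx]

/-- The pair `(a, b)` can be modified beyond `M` so as to follow any modification of its commutator
far away, without creating common fixed points. -/
def CommutatorExtendsPast (a b : ℝ ≃o ℝ) (M : ℝ) : Prop :=
  ∃ R, ∀ V ∈ trivialGermAtTop, (∀ x ≤ R, V x = ⁅a, b⁆ x) →
    ∃ a' b' : ℝ ≃o ℝ, (∀ x ≤ M, a' x = a x) ∧ (∀ x ≤ M, b' x = b x) ∧ ⁅a', b'⁆ = V ∧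
      ∀ x, a' x = x → b' x = x → x ≤ R ∧ a x = x ∧ b x = x

theorem CommutatorExtendsPast.swap {a b : ℝ ≃o ℝ} {M : ℝ} (h : CommutatorExtendsPast a b M) :
    CommutatorExtendsPast b a M := by
  obtain ⟨R, hR⟩ := h
  -- Evaluating V⁻¹ up to R requires knowing V up to ⁅a, b⁆ R.
  refine ⟨max R (⁅a, b⁆ R), fun V hV hVR => ?_⟩
  obtain ⟨a', b', h1, h2, h3, h4⟩ := hR V⁻¹ (inv_mem hV) (fun x hx => by
    rw [← V.injective.eq_iff, RelIso.apply_inv_self, hVR, ← commutatorElement_inv,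
      RelIso.inv_apply_self]
    exact ((⁅a, b⁆ : ℝ ≃o ℝ).monotone hx).trans (le_max_right _ _))
  refine ⟨b', a', h2, h1, by rw [← commutatorElement_inv, h3, inv_inv], fun x hb ha => ?_⟩
  obtain ⟨h5, h6, h7⟩ := h4 x ha hb
  exact ⟨h5.trans (le_max_left _ _), h7, h6⟩

/-- Keep f up to S and continue it so that f' and V f' both move points to the right, past Y and h Y
respectively. Up to S, V f' is still h f h⁻¹, so h conjugates f' to V f' on (-∞, Y] and extends to a
global conjugacy h'. Past Y, f' has no fixed points; before Y nothing has changed. -/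
theorem commutatorExtendsPast_of_gt {h f : ℝ ≃o ℝ} {M Y S : ℝ} (hMY : M ≤ Y) (hYS : Y ≤ S)
    (hhY : h Y ≤ S) (hf : ∀ x, Y ≤ x → (x ≤ S ∨ h x ≤ S) → x < f x) :
    CommutatorExtendsPast h f M := by
  have hVS : ∀ x, h Y ≤ x → x ≤ S → x < (⁅h, f⁆ : ℝ ≃o ℝ) (f x) := by
    intro x hx hx'
    simp only [commutatorElement_def, RelIso.mul_apply, RelIso.inv_apply_self]
    rw [← inv_apply_lt]
    refine hf _ ?_ (Or.inr (by rwa [RelIso.apply_inv_self]))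
    rw [← h.le_iff_le, RelIso.apply_inv_self]
    exact hx
  have hfS : S < f S := hf S hYS (Or.inl le_rfl)
  refine ⟨f S, fun V _ hV => ?_⟩
  have hVf : ∀ x ≤ S, V (f x) = (⁅h, f⁆ : ℝ ≃o ℝ) (f x) := fun x hx => hV _ (f.monotone hx)
  -- This δ makes the two pieces of f' match at S; its positivity keeps f' and V f' above the
  -- identity.
  obtain ⟨δ, hδ⟩ : ∃ δ, δ = f S - max S (V⁻¹ S) := ⟨_, rfl⟩
  have hδ0 : 0 < δ := by
    rw [hδ, sub_pos, max_lt_iff, inv_apply_lt, hVf S le_rfl]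
    exact ⟨hfS, hVS S hhY le_rfl⟩
  obtain ⟨u, hu⟩ := OrderIso.exists_coe_eq_of_continuous (f := fun x => max x (V⁻¹ x) + δ) (by
      intro x y hxy
      have h1 : max x (V⁻¹ x) < max y (V⁻¹ y) := max_lt_max hxy (V⁻¹.strictMono hxy)
      dsimp only
      linarith) (by
      have := (V⁻¹).continuous
      fun_prop) (tendsto_atTop_add_const_right _ _
        (tendsto_atTop_mono (fun x => le_max_left _ _) tendsto_id)) (by
      refine tendsto_atBot_add_const_right _ _ ?_
      rw [tendsto_atBot]
      intro C
      filter_upwards [eventually_le_atBot C, eventually_le_atBot (V C)] with x h1 h2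
      exact max_le h1 (inv_apply_le.2 h2))
  obtain ⟨f', hf1, hf2⟩ := OrderIso.exists_glue f u (p := S) (by rw [hu, hδ]; ring)
  have hfgt : ∀ x, Y ≤ x → x < f' x := by
    intro x hx
    rcases le_total x S with h1 | h1
    · rw [hf1 x h1]
      exact hf x hx (Or.inl h1)
    · rw [hf2 x h1, hu]
      linarith [le_max_left x (V⁻¹ x)]
  have hggt : ∀ x, h Y ≤ x → x < V (f' x) := by
    intro x hx
    rcases le_total x S with h1 | h1
    · rw [hf1 x h1, hVf x h1]
      exact hVS x hx h1
    · rw [hf2 x h1, ← inv_apply_lt, hu]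
      linarith [le_max_right x (V⁻¹ x)]
  have hYD : ∀ x ≤ Y, f'⁻¹ x ≤ Y := fun x hx => inv_apply_le.2 (hx.trans (hfgt Y le_rfl).le)
  -- Inverses are used because it is the backward orbits of f' that enter (-∞, Y].
  obtain ⟨h', hD, hc⟩ := OrderIso.exists_conj_of_eventually f'⁻¹ (V * f')⁻¹ h (Iic Y) hYD
    (by
      intro x hx
      have h1 : f'⁻¹ x ≤ Y := hYD x hx
      obtain ⟨z, rfl⟩ : ∃ z, x = f' z := ⟨f'⁻¹ x, by rw [RelIso.apply_inv_self]⟩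
      rw [RelIso.inv_apply_self] at h1 ⊢
      rw [← (V * f').injective.eq_iff, RelIso.apply_inv_self, RelIso.mul_apply]
      have h2 : h z ≤ S := (h.monotone h1).trans hhY
      rw [hf1 _ h2, hVf _ h2, hf1 _ (h1.trans hYS)]
      simp [commutatorElement_def])
    (fun x => OrderIso.exists_iterate_le f'⁻¹ (fun y hy => inv_apply_lt.2 (hfgt y hy)) x)
    (fun y => by
      obtain ⟨n, hn⟩ := OrderIso.exists_iterate_le (V * f')⁻¹
        (fun y hy => inv_apply_lt.2 (hggt y hy)) y
      refine ⟨n, h⁻¹ (((V * f')⁻¹ ^ n) y), inv_apply_le.2 hn, ?_⟩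
      rw [RelIso.apply_inv_self])
  refine ⟨h', f', fun x hx => hD x (hx.trans hMY), fun x hx => hf1 x (hx.trans (hMY.trans hYS)),
    ?_, ?_⟩
  · rw [commutatorElement_eq_iff_apply]
    intro x
    have := hc (f' x)
    rw [RelIso.inv_apply_self, ← (V * f').injective.eq_iff, RelIso.apply_inv_self] at this
    exact this.symm
  · intro x h1 h2
    have hxY : x < Y := by
      by_contra! h3
      exact (hfgt x h3).ne' h2
    rw [hD x hxY.le] at h1
    rw [hf1 x (hxY.le.trans hYS)] at h2
    exact ⟨by linarith, h1, h2⟩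

/-- The same construction with f moving points to the left; forward orbits now enter (-∞, Y]. -/
theorem commutatorExtendsPast_of_lt {h f : ℝ ≃o ℝ} {M Y S : ℝ} (hMY : M ≤ Y) (hYS : Y ≤ S)
    (hhY : h Y ≤ S) (hf : ∀ x, Y ≤ x → (x ≤ S ∨ h x ≤ S) → f x < x) :
    CommutatorExtendsPast h f M := by
  have hVS : ∀ x, h Y ≤ x → x ≤ S → (⁅h, f⁆ : ℝ ≃o ℝ) (f x) < x := by
    intro x hx hx'
    simp only [commutatorElement_def, RelIso.mul_apply, RelIso.inv_apply_self]
    rw [← lt_inv_apply]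
    refine hf _ ?_ (Or.inr (by rwa [RelIso.apply_inv_self]))
    rw [← h.le_iff_le, RelIso.apply_inv_self]
    exact hx
  have hfS : f S < S := hf S hYS (Or.inl le_rfl)
  refine ⟨S, fun V _ hV => ?_⟩
  have hVf : ∀ x ≤ S, V (f x) = (⁅h, f⁆ : ℝ ≃o ℝ) (f x) := fun x hx =>
    hV _ ((f.monotone hx).trans hfS.le)
  obtain ⟨δ, hδ⟩ : ∃ δ, δ = min S (V⁻¹ S) - f S := ⟨_, rfl⟩
  have hδ0 : 0 < δ := by
    rw [hδ, sub_pos, lt_min_iff, lt_inv_apply, hVf S le_rfl]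
    exact ⟨hfS, hVS S hhY le_rfl⟩
  obtain ⟨u, hu⟩ := OrderIso.exists_coe_eq_of_continuous (f := fun x => min x (V⁻¹ x) + -δ) (by
      intro x y hxy
      have h1 : min x (V⁻¹ x) < min y (V⁻¹ y) := min_lt_min hxy (V⁻¹.strictMono hxy)
      dsimp only
      linarith) (by
      have := (V⁻¹).continuous
      fun_prop) (by
      refine tendsto_atTop_add_const_right _ _ ?_
      rw [tendsto_atTop]
      intro C
      filter_upwards [eventually_ge_atTop C, eventually_ge_atTop (V C)] with x h1 h2
      refine le_min h1 ?_
      rwa [← V.le_iff_le, RelIso.apply_inv_self]) (tendsto_atBot_add_const_right _ _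
        (tendsto_atBot_mono (fun x => min_le_left _ _) tendsto_id))
  obtain ⟨f', hf1, hf2⟩ := OrderIso.exists_glue f u (p := S) (by rw [hu, hδ]; ring)
  have hflt : ∀ x, Y ≤ x → f' x < x := by
    intro x hx
    rcases le_total x S with h1 | h1
    · rw [hf1 x h1]
      exact hf x hx (Or.inl h1)
    · rw [hf2 x h1, hu]
      linarith [min_le_left x (V⁻¹ x)]
  have hglt : ∀ x, h Y ≤ x → V (f' x) < x := by
    intro x hx
    rcases le_total x S with h1 | h1
    · rw [hf1 x h1, hVf x h1]
      exact hVS x hx h1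
    · rw [hf2 x h1, ← lt_inv_apply, hu]
      linarith [min_le_right x (V⁻¹ x)]
  obtain ⟨h', hD, hc⟩ := OrderIso.exists_conj_of_eventually f' (V * f') h (Iic Y)
    (fun x hx => (f'.monotone hx).trans (hflt Y le_rfl).le)
    (by
      intro x hx
      rw [mem_Iic] at hx
      rw [RelIso.mul_apply]
      have h2 : h x ≤ S := (h.monotone hx).trans hhY
      rw [hf1 _ h2, hVf _ h2, hf1 _ (hx.trans hYS)]
      simp [commutatorElement_def])
    (fun x => OrderIso.exists_iterate_le f' hflt x)
    (fun y => by
      obtain ⟨n, hn⟩ := OrderIso.exists_iterate_le (V * f') hglt y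
      refine ⟨n, h⁻¹ (((V * f') ^ n) y), inv_apply_le.2 hn, ?_⟩
      rw [RelIso.apply_inv_self])
  refine ⟨h', f', fun x hx => hD x (hx.trans hMY), fun x hx => hf1 x (hx.trans (hMY.trans hYS)),
    commutatorElement_eq_iff_apply.2 hc, ?_⟩
  intro x h1 h2
  have hxY : x < Y := by
    by_contra! h3
    exact (hflt x h3).ne h2
  rw [hD x hxY.le] at h1
  rw [hf1 x (hxY.le.trans hYS)] at h2
  exact ⟨by linarith, h1, h2⟩

/-- If a fixes some p ≥ M, take Y = S = p: either b moves p, and the previous constructions need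
only that one point, or p is a common fixed point past which the pair can be replaced freely. If a
fixes no such point, it moves all of [M, ∞) in one direction and plays the role of f. -/
theorem commutatorExtendsPast (a b : ℝ ≃o ℝ) (M : ℝ) : CommutatorExtendsPast a b M := by
  by_cases hfix : ∃ p, M ≤ p ∧ a p = p
  · obtain ⟨p, hp, hap⟩ := hfix
    have hle : ∀ x, p ≤ x → (x ≤ p ∨ a x ≤ p) → x = p := by
      rintro x h1 (h2 | h2)
      · exact le_antisymm h2 h1
      · rw [← hap, a.le_iff_le] at h2
        exact le_antisymm h2 h1
    rcases lt_trichotomy (b p) p with h | h | h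
    · refine commutatorExtendsPast_of_lt hp le_rfl hap.le fun x h1 h2 => ?_
      rw [hle x h1 h2]; exact h
    · refine ⟨p, fun V hV hVp => ?_⟩
      obtain ⟨a', b', h1, h2, h3, h4, -, -⟩ :=
        exists_commutator_eq_of_fixed hap h hVp hV (Or.inl rfl)
      refine ⟨a', b', fun x hx => h1 x (hx.trans hp), fun x hx => h2 x (hx.trans hp), h3,
        fun x hx hx' => ?_⟩
      have hxp : x ≤ p := by
        by_contra! h5
        exact h4 x h5 hx
      exact ⟨hxp, by rw [← h1 x hxp, hx], by rw [← h2 x hxp, hx']⟩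
    · refine commutatorExtendsPast_of_gt hp le_rfl hap.le fun x h1 h2 => ?_
      rw [hle x h1 h2]; exact h
  · push Not at hfix
    apply CommutatorExtendsPast.swap
    have hcont : ContinuousOn (fun x => a x - x) (Ici M) :=
      (a.continuous.sub continuous_id).continuousOn
    rcases lt_or_gt_of_ne (hfix M le_rfl) with h | h
    · refine commutatorExtendsPast_of_lt le_rfl (le_max_left M (b M)) (le_max_right _ _)
        fun x hx _ => ?_
      by_contra! hc
      obtain ⟨z, hz, hz'⟩ := intermediate_value_Icc hx
        (hcont.mono Icc_subset_Ici_self) (show (0 : ℝ) ∈ Icc _ _ from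
          ⟨by linarith, by linarith⟩)
      exact hfix z hz.1 (by linarith)
    · refine commutatorExtendsPast_of_gt le_rfl (le_max_left M (b M)) (le_max_right _ _)
        fun x hx _ => ?_
      by_contra! hc
      obtain ⟨z, hz, hz'⟩ := intermediate_value_Icc' hx
        (hcont.mono Icc_subset_Ici_self) (show (0 : ℝ) ∈ Icc _ _ from
          ⟨by linarith, by linarith⟩)
      exact hfix z hz.1 (by linarith)

/-! ### Making an action standard near the ends -/

/-- The product of commutators `⁅a₀, b₀⁆ ⁅a₁, b₁⁆ ⋯`. -/
def commutatorProd {G : Type*} [Group G] {m : ℕ} (a b : Fin m → G) : G :=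
  (List.ofFn fun i => ⁅a i, b i⁆).prod

theorem commutatorProd_succ {G : Type*} [Group G] {m : ℕ} (a b : Fin (m + 1) → G) :
    commutatorProd a b =
      ⁅a 0, b 0⁆ * commutatorProd (fun i => a i.succ) (fun i => b i.succ) := by
  simp [commutatorProd, List.ofFn_succ]

theorem lift_surfaceRelator {G : Type*} [Group G] {q : ℕ} (v : Fin q ⊕ Fin q → G) :
    FreeGroup.lift v (surfaceRelator q) =
      commutatorProd (fun i => v (Sum.inl i)) (fun i => v (Sum.inr i)) := by
  simp only [surfaceRelator, commutatorProd, map_list_prod, List.map_ofFn]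
  congr 2
  funext i
  simp [commutatorElement_def]

theorem commutatorElement_mem {G : Type*} [Group G] (H : Subgroup G) {a b : G} (ha : a ∈ H)
    (hb : b ∈ H) : ⁅a, b⁆ ∈ H := by
  rw [commutatorElement_def]
  exact mul_mem (mul_mem (mul_mem ha hb) (inv_mem ha)) (inv_mem hb)

theorem commutatorProd_mem {G : Type*} [Group G] (H : Subgroup G) {m : ℕ} {a b : Fin m → G}
    (ha : ∀ i, a i ∈ H) (hb : ∀ i, b i ∈ H) : commutatorProd a b ∈ H := by
  refine list_prod_mem fun x hx => ?_
  rw [List.mem_ofFn] at hx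
  obtain ⟨i, rfl⟩ := hx
  exact commutatorElement_mem H (ha i) (hb i)

/-- The value of a word on a left half-line depends only on the values of the letters on a left
half-line. -/
theorem exists_forall_le_lift_apply_eq {α : Type*} (w : FreeGroup α) (v : α → ℝ ≃o ℝ) (R : ℝ) :
    ∃ R', ∀ u : α → ℝ ≃o ℝ, (∀ s, ∀ x ≤ R', u s x = v s x) →
      ∀ x ≤ R, FreeGroup.lift u w x = FreeGroup.lift v w x := by
  induction w using FreeGroup.induction_on generalizing R with
  | C1 => exact ⟨R, fun u _ x _ => by simp⟩
  | of s => exact ⟨R, fun u hu x hx => by simpa using hu s x hx⟩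
  | inv_of s _ =>
    refine ⟨(v s)⁻¹ R, fun u hu x hx => ?_⟩
    simp only [map_inv, FreeGroup.lift_apply_of]
    rw [← (u s).injective.eq_iff, RelIso.apply_inv_self, hu s _ ((v s)⁻¹.monotone hx),
      RelIso.apply_inv_self]
  | mul w₁ w₂ h₁ h₂ =>
    obtain ⟨R₂, h₂⟩ := h₂ R
    obtain ⟨R₁, h₁⟩ := h₁ (FreeGroup.lift v w₂ R)
    refine ⟨max R₁ R₂, fun u hu x hx => ?_⟩
    simp only [map_mul, RelIso.mul_apply]
    rw [h₂ u (fun s y hy => hu s y (hy.trans (le_max_right _ _))) x hx,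
      h₁ u (fun s y hy => hu s y (hy.trans (le_max_left _ _))) _
        ((FreeGroup.lift v w₂).monotone hx)]

/-- The homomorphism to the translations of the line which is `1` on the second generator `a` and
`0` on the other generators. -/
def standardShift (n : ℕ) (s : Fin (n + 2) ⊕ Fin (n + 2)) : ℝ :=
  if s = Sum.inl 1 then 1 else 0

/-- Two corrections are made. The first pair compensates for truncating the others, but may then be
wild at +∞. It is therefore truncated too, beyond a point P fixed by the second pair, and that pair
is replaced past P to restore the relation, with a₂ fixed-point free there. -/
theorem exists_standard_at_top {n : ℕ} (v : Fin (n + 2) ⊕ Fin (n + 2) → ℝ ≃o ℝ)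
    (hv : FreeGroup.lift v (surfaceRelator (n + 2)) = 1) (hfix : ∀ x, ∃ s, v s x ≠ x) (M : ℝ)
    {ε : ℝ} (hε : ε = 1 ∨ ε = -1) :
    ∃ u : Fin (n + 2) ⊕ Fin (n + 2) → ℝ ≃o ℝ,
      FreeGroup.lift u (surfaceRelator (n + 2)) = 1 ∧ (∀ x, ∃ s, u s x ≠ x) ∧
      (∀ s, ∀ x ≤ M, u s x = v s x) ∧
      ∀ᶠ x in atTop, ∀ s, u s x = x + ε * standardShift n s := by
  obtain ⟨a, ha⟩ : ∃ a : Fin (n + 2) → ℝ ≃o ℝ, a = fun i => v (Sum.inl i) := ⟨_, rfl⟩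
  obtain ⟨b, hb⟩ : ∃ b : Fin (n + 2) → ℝ ≃o ℝ, b = fun i => v (Sum.inr i) := ⟨_, rfl⟩
  have hrel : ⁅a 0, b 0⁆ =
      (commutatorProd (fun i : Fin (n + 1) => a i.succ) (fun i => b i.succ))⁻¹ := by
    rw [lift_surfaceRelator, ← ha, ← hb, commutatorProd_succ] at hv
    exact eq_inv_of_mul_eq_one_left hv
  obtain ⟨R, hR⟩ := commutatorExtendsPast (a 0) (b 0) M
  obtain ⟨R', hR'⟩ := exists_forall_le_lift_apply_eq (surfaceRelator (n + 1))⁻¹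
    (Sum.elim (fun i => a i.succ) (fun i => b i.succ)) R
  obtain ⟨R₂, h₂, h₂', h₂''⟩ : ∃ R₂, R' ≤ R₂ ∧ R ≤ R₂ ∧ M ≤ R₂ :=
    ⟨max R' (max R M), le_max_left _ _, (le_max_left R M).trans (le_max_right _ _),
      (le_max_right R M).trans (le_max_right _ _)⟩
  choose c hc hc' using fun f => OrderIso.exists_eventually_id f R₂
  obtain ⟨at', hat'⟩ : ∃ at' : Fin (n + 1) → ℝ ≃o ℝ, at' = fun i => c (a i.succ) := ⟨_, rfl⟩
  obtain ⟨bt, hbt⟩ : ∃ bt : Fin (n + 1) → ℝ ≃o ℝ, bt = fun i => c (b i.succ) := ⟨_, rfl⟩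
  have hatle : ∀ i, ∀ x ≤ R₂, at' i x = a i.succ x := fun i x hx => by rw [hat']; exact hc _ x hx
  have hbtle : ∀ i, ∀ x ≤ R₂, bt i x = b i.succ x := fun i x hx => by rw [hbt]; exact hc _ x hx
  have hatg : ∀ i, at' i ∈ trivialGermAtTop := fun i => by rw [hat']; exact hc' _
  have hbtg : ∀ i, bt i ∈ trivialGermAtTop := fun i => by rw [hbt]; exact hc' _
  obtain ⟨V', hV'⟩ : ∃ V', V' = (commutatorProd at' bt)⁻¹ := ⟨_, rfl⟩
  have hV'g : V' ∈ trivialGermAtTop := hV' ▸ inv_mem (commutatorProd_mem _ hatg hbtg)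
  have hV'R : ∀ x ≤ R, V' x = (⁅a 0, b 0⁆ : ℝ ≃o ℝ) x := by
    intro x hx
    have := hR' (Sum.elim at' bt) (by
      rintro (i | i) y hy
      · exact hatle i y (hy.trans h₂)
      · exact hbtle i y (hy.trans h₂)) x hx
    simpa only [map_inv, lift_surfaceRelator, Sum.elim_inl, Sum.elim_inr, ← hV', ← hrel] using this
  obtain ⟨a₀, b₀, ha₀, hb₀, hab₀, hfix₀⟩ := hR V' hV'g hV'R
  obtain ⟨rest, hrest⟩ : ∃ rest, rest =
    commutatorProd (fun i : Fin n => at' i.succ) (fun i => bt i.succ) := ⟨_, rfl⟩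
  have hrestg : rest ∈ trivialGermAtTop :=
    hrest ▸ commutatorProd_mem _ (fun i => hatg _) (fun i => hbtg _)
  have hV'rest : V'⁻¹ = ⁅at' 0, bt 0⁆ * rest := by
    rw [hV', inv_inv, commutatorProd_succ, hrest]
  obtain ⟨P, hP⟩ : ∃ P, M ≤ P ∧ V' P = P ∧ rest P = P ∧ at' 0 P = P ∧ bt 0 P = P :=
    ((eventually_ge_atTop M).and ((mem_trivialGermAtTop.1 hV'g).and
      ((mem_trivialGermAtTop.1 hrestg).and ((mem_trivialGermAtTop.1 (hatg 0)).and
        (mem_trivialGermAtTop.1 (hbtg 0)))))).exists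
  obtain ⟨hMP, hV'P, hrestP, hatP, hbtP⟩ := hP
  obtain ⟨P₁, hP₁⟩ := exists_forall_le_lift_apply_eq
    ⁅FreeGroup.of true, FreeGroup.of false⁆ (fun i => if i then a₀ else b₀) P
  obtain ⟨a₁, ha₁, ha₁'⟩ := OrderIso.exists_eventually_id a₀ (max P₁ P)
  obtain ⟨b₁, hb₁, hb₁'⟩ := OrderIso.exists_eventually_id b₀ (max P₁ P)
  have hV : ∀ x ≤ P, (⁅a₁, b₁⁆ : ℝ ≃o ℝ) x = V' x := by
    intro x hx
    have := hP₁ (fun i => if i then a₁ else b₁) (by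
      rintro (_ | _) y hy
      · simpa using hb₁ y (hy.trans (le_max_left _ _))
      · simpa using ha₁ y (hy.trans (le_max_left _ _))) x hx
    simpa [map_commutatorElement, hab₀] using this
  -- The prescribed commutator is the one the relation forces on the second handle; up to P it is
  -- the old one, because ⁅a₁, b₁⁆ agrees with V' there.
  obtain ⟨a₂, b₂, ha₂, hb₂, hab₂, hne, hb₂g, ha₂g⟩ := exists_commutator_eq_of_fixed
    (V := ⁅a₁, b₁⁆⁻¹ * rest⁻¹) hatP hbtP (by
      intro x hx
      rw [RelIso.mul_apply, ← (⁅a₁, b₁⁆ : ℝ ≃o ℝ).injective.eq_iff, RelIso.apply_inv_self]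
      obtain ⟨y, rfl⟩ : ∃ y, x = rest y := ⟨rest⁻¹ x, by rw [RelIso.apply_inv_self]⟩
      rw [RelIso.inv_apply_self]
      have hy : y ≤ P := by rwa [← rest.le_iff_le, hrestP]
      have h1 : (⁅at' 0, bt 0⁆ : ℝ ≃o ℝ) (rest y) = V'⁻¹ y := by rw [hV'rest]; rfl
      rw [h1, hV _ (inv_apply_le.2 (by rwa [hV'P])), RelIso.apply_inv_self])
    (mul_mem (inv_mem (commutatorElement_mem _ ha₁' hb₁')) (inv_mem hrestg)) hε
  obtain ⟨A, hA⟩ : ∃ A : Fin (n + 2) → ℝ ≃o ℝ,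
    A = Fin.cons a₁ (Fin.cons a₂ fun i => at' i.succ) := ⟨_, rfl⟩
  obtain ⟨B, hB⟩ : ∃ B : Fin (n + 2) → ℝ ≃o ℝ,
    B = Fin.cons b₁ (Fin.cons b₂ fun i => bt i.succ) := ⟨_, rfl⟩
  have hAle : ∀ i : Fin (n + 1), ∀ x ≤ P, A i.succ x = at' i x := by
    intro i x hx
    rw [hA]
    refine Fin.cases ?_ (fun i => ?_) i
    · simpa using ha₂ x hx
    · simp
  have hBle : ∀ i : Fin (n + 1), ∀ x ≤ P, B i.succ x = bt i x := by
    intro i x hx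
    rw [hB]
    refine Fin.cases ?_ (fun i => ?_) i
    · simpa using hb₂ x hx
    · simp
  have hA0 : A 0 = a₁ := by rw [hA]; rfl
  have hB0 : B 0 = b₁ := by rw [hB]; rfl
  have hA0le : ∀ x ≤ P, A 0 x = a₀ x := fun x hx => by
    rw [hA0]; exact ha₁ x (hx.trans (le_max_right _ _))
  have hB0le : ∀ x ≤ P, B 0 x = b₀ x := fun x hx => by
    rw [hB0]; exact hb₁ x (hx.trans (le_max_right _ _))
  refine ⟨Sum.elim A B, ?_, ?_, ?_, ?_⟩
  · rw [lift_surfaceRelator]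
    simp only [Sum.elim_inl, Sum.elim_inr]
    rw [commutatorProd_succ, commutatorProd_succ, hA, hB]
    simp only [Fin.cons_zero, Fin.cons_succ, ← hrest]
    rw [hab₂]
    group
  · intro x
    by_contra! hx
    have hxA : ∀ i, A i x = x := fun i => hx (Sum.inl i)
    have hxB : ∀ i, B i x = x := fun i => hx (Sum.inr i)
    have hxP : x ≤ P := by
      by_contra! h
      apply hne x h
      have := hxA 1
      rwa [hA] at this
    obtain ⟨hxR, h1, h2⟩ := hfix₀ x (by rw [← hA0le x hxP, hxA]) (by rw [← hB0le x hxP, hxB])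
    obtain ⟨s, hs⟩ := hfix x
    apply hs
    rcases s with i | i
    · change (fun i => v (Sum.inl i)) i x = x
      rw [← ha]
      refine Fin.cases h1 (fun i => ?_) i
      rw [← hatle i x (hxR.trans h₂'), ← hAle i x hxP, hxA]
    · change (fun i => v (Sum.inr i)) i x = x
      rw [← hb]
      refine Fin.cases h2 (fun i => ?_) i
      rw [← hbtle i x (hxR.trans h₂'), ← hBle i x hxP, hxB]
  · rintro (i | i) x hx
    · change A i x = (fun i => v (Sum.inl i)) i x
      rw [← ha]
      refine Fin.cases ?_ (fun i => ?_) i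
      · rw [hA0le x (hx.trans hMP), ha₀ x hx]
      · rw [hAle i x (hx.trans hMP), hatle i x (hx.trans h₂'')]
    · change B i x = (fun i => v (Sum.inr i)) i x
      rw [← hb]
      refine Fin.cases ?_ (fun i => ?_) i
      · rw [hB0le x (hx.trans hMP), hb₀ x hx]
      · rw [hBle i x (hx.trans hMP), hbtle i x (hx.trans h₂'')]
  · rw [eventually_all]
    rintro (i | i)
    · refine Fin.cases ?_ (Fin.cases ?_ fun i => ?_) i
      · filter_upwards [ha₁'] with x hx
        simp [standardShift, hA0, hx]
      · filter_upwards [ha₂g] with x hx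
        have : A (Fin.succ 0) = a₂ := by rw [hA]; rfl
        rw [Sum.elim_inl, this, hx]
        simp [standardShift]
      · filter_upwards [hatg i.succ] with x hx
        have : A i.succ.succ = at' i.succ := by rw [hA]; rfl
        have h1 : i.succ.succ ≠ 1 := by
          rw [← Fin.succ_zero_eq_one, Ne, Fin.succ_inj]
          exact Fin.succ_ne_zero i
        simp [standardShift, this, hx, h1]
    · refine Fin.cases ?_ (Fin.cases ?_ fun i => ?_) i
      · filter_upwards [hb₁'] with x hx
        simp [standardShift, hB0, hx]
      · filter_upwards [hb₂g] with x hx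
        have : B (Fin.succ 0) = b₂ := by rw [hB]; rfl
        rw [Sum.elim_inr, this, hx]
        simp [standardShift]
      · filter_upwards [hbtg i.succ] with x hx
        have : B i.succ.succ = bt i.succ := by rw [hB]; rfl
        simp [standardShift, this, hx]

theorem map_lift_apply_of_semiconj {α : Type*} {φ : ℝ → ℝ} {u v : α → ℝ ≃o ℝ}
    (h : ∀ s x, φ (u s x) = v s (φ x)) (w : FreeGroup α) (x : ℝ) :
    φ (FreeGroup.lift u w x) = FreeGroup.lift v w (φ x) := by
  induction w using FreeGroup.induction_on generalizing x with
  | C1 => simp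
  | of s => simpa using h s x
  | inv_of s _ =>
    simp only [map_inv, FreeGroup.lift_apply_of]
    rw [← (v s).injective.eq_iff, ← h, RelIso.apply_inv_self, RelIso.apply_inv_self]
  | mul w₁ w₂ h₁ h₂ => simp only [map_mul, RelIso.mul_apply, h₁, h₂]

/-- Only injectivity of φ is required, so this covers conjugation as well as restriction to an
invariant half-line. -/
theorem lift_eq_one_of_semiconj {α : Type*} {φ : ℝ → ℝ} (hφ : Function.Injective φ)
    {u v : α → ℝ ≃o ℝ} (h : ∀ s x, φ (u s x) = v s (φ x)) {w : FreeGroup α}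
    (hw : FreeGroup.lift v w = 1) : FreeGroup.lift u w = 1 := by
  refine DFunLike.ext _ _ fun x => hφ ?_
  rw [map_lift_apply_of_semiconj h, hw]
  rfl

theorem OrderIso.exists_reflect (f : ℝ ≃o ℝ) : ∃ e : ℝ ≃o ℝ, ∀ x, e x = -f (-x) := by
  have hm : StrictMono fun x => -f (-x) := fun x y hxy =>
    neg_lt_neg (f.strictMono (neg_lt_neg hxy))
  refine ⟨hm.orderIsoOfSurjective _ fun y => ⟨-f.symm (-y), by simp⟩, fun x => rfl⟩

/-- An action of a surface group on the line without global fixed points can be modified outside a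
compact set so as to become an action by translations near `±∞`. -/
theorem exists_standard {n : ℕ} (v : Fin (n + 2) ⊕ Fin (n + 2) → ℝ ≃o ℝ)
    (hv : FreeGroup.lift v (surfaceRelator (n + 2)) = 1) (hfix : ∀ x, ∃ s, v s x ≠ x) (M : ℝ) :
    ∃ u : Fin (n + 2) ⊕ Fin (n + 2) → ℝ ≃o ℝ,
      FreeGroup.lift u (surfaceRelator (n + 2)) = 1 ∧ (∀ x, ∃ s, u s x ≠ x) ∧
      (∀ s x, |x| ≤ M → u s x = v s x) ∧
      ∃ L, ∀ s x, L ≤ |x| → u s x = x + standardShift n s := by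
  obtain ⟨u₁, h₁, h₁f, h₁M, h₁L⟩ := exists_standard_at_top v hv hfix M (Or.inl rfl)
  obtain ⟨L₁, hL₁⟩ := eventually_atTop.1 h₁L
  choose r hr using fun s => OrderIso.exists_reflect (u₁ s)
  -- The window includes |L₁| so that the end already treated stays standard; the shift −1 becomes
  -- +1 when reflected back.
  obtain ⟨u₂, h₂, h₂f, h₂M, h₂L⟩ := exists_standard_at_top r
    (lift_eq_one_of_semiconj neg_injective (fun s x => by rw [hr, neg_neg]) h₁)
    (fun x => by
      obtain ⟨s, hs⟩ := h₁f (-x)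
      exact ⟨s, fun h => hs (by rw [hr] at h; linarith)⟩) (max M |L₁|) (Or.inr rfl)
  obtain ⟨L₂, hL₂⟩ := eventually_atTop.1 h₂L
  choose u hu using fun s => OrderIso.exists_reflect (u₂ s)
  have hu₁ : ∀ s x, -max M |L₁| ≤ x → u s x = u₁ s x := fun s x hx => by
    rw [hu, h₂M s (-x) (by linarith), hr, neg_neg, neg_neg]
  refine ⟨u, lift_eq_one_of_semiconj neg_injective (fun s x => by rw [hu, neg_neg]) h₂,
    fun x => ?_, fun s x hx => ?_, max |L₁| |L₂|, fun s x hx => ?_⟩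
  · obtain ⟨s, hs⟩ := h₂f (-x)
    exact ⟨s, fun h => hs (by rw [hu] at h; linarith)⟩
  · rw [abs_le] at hx
    rw [hu₁ s x (by linarith [le_max_left M |L₁|]), h₁M s x hx.2]
  · have h3 := le_max_left |L₁| |L₂|
    have h4 := le_max_right |L₁| |L₂|
    have h5 := le_max_right M |L₁|
    rcases le_total 0 x with h0 | h0
    · rw [abs_of_nonneg h0] at hx
      rw [hu₁ s x (by linarith [abs_nonneg L₁]), hL₁ x (by linarith [le_abs_self L₁]), one_mul]
    · rw [abs_of_nonpos h0] at hx
      rw [hu, hL₂ (-x) (by linarith [le_abs_self L₂])]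
      ring

/-! ### Concatenating and gluing actions -/

/-- On an interval near whose endpoints the letters act by translations, the value of a word depends
only on the values of the letters near this interval. -/
theorem exists_forall_mem_Icc_lift_apply_eq {α : Type*} {τ : α → ℝ} (hτ : ∀ s, |τ s| ≤ 1)
    (w : FreeGroup α) :
    ∃ k : ℝ, 0 ≤ k ∧ ∀ (u v : α → ℝ ≃o ℝ) (A B : ℝ),
      (∀ s, ∀ x ∈ Icc (A - k) (B + k), u s x = v s x) →
      (∀ s x, |x - A| ≤ k → u s x = x + τ s) → (∀ s x, |x - B| ≤ k → u s x = x + τ s) →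
      ∀ x ∈ Icc A B, FreeGroup.lift u w x = FreeGroup.lift v w x ∧
        FreeGroup.lift u w x ∈ Icc (A - k) (B + k) := by
  induction w using FreeGroup.induction_on with
  | C1 =>
    refine ⟨0, le_rfl, fun u v A B _ _ _ x hx => ⟨by simp, by simpa using hx⟩⟩
  | of s =>
    refine ⟨1, zero_le_one, fun u v A B h hA hB x hx => ?_⟩
    have h1 := hA s A (by simp)
    have h2 := hB s B (by simp)
    have h3 := (u s).monotone hx.1
    have h4 := (u s).monotone hx.2
    have h5 := abs_le.1 (hτ s)
    rw [FreeGroup.lift_apply_of, FreeGroup.lift_apply_of]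
    exact ⟨h s x ⟨by linarith [hx.1], by linarith [hx.2]⟩, by linarith, by linarith⟩
  | inv_of s _ =>
    refine ⟨1, zero_le_one, fun u v A B h hA hB x hx => ?_⟩
    have h1 := hA s (A - 1) (by simp)
    have h2 := hB s (B + 1) (by simp)
    have h5 := abs_le.1 (hτ s)
    have h6 : (u s)⁻¹ x ∈ Icc (A - 1) (B + 1) := by
      constructor
      · rw [← (u s).le_iff_le, RelIso.apply_inv_self]; linarith [hx.1]
      · rw [← (u s).le_iff_le, RelIso.apply_inv_self]; linarith [hx.2]
    rw [map_inv, map_inv, FreeGroup.lift_apply_of, FreeGroup.lift_apply_of]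
    refine ⟨?_, h6⟩
    rw [← (v s).injective.eq_iff, RelIso.apply_inv_self, ← h s _ h6, RelIso.apply_inv_self]
  | mul w₁ w₂ h₁ h₂ =>
    obtain ⟨k₁, hk₁, h₁⟩ := h₁
    obtain ⟨k₂, hk₂, h₂⟩ := h₂
    refine ⟨k₁ + k₂, by linarith, fun u v A B h hA hB x hx => ?_⟩
    obtain ⟨h3, h4⟩ := h₂ u v A B
      (fun s y hy => h s y ⟨by linarith [hy.1], by linarith [hy.2]⟩)
      (fun s y hy => hA s y (by linarith)) (fun s y hy => hB s y (by linarith)) x hx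
    obtain ⟨h5, h6⟩ := h₁ u v (A - k₂) (B + k₂)
      (fun s y hy => h s y ⟨by linarith [hy.1], by linarith [hy.2]⟩)
      (fun s y hy => hA s y (by
        rw [abs_le] at hy ⊢
        constructor <;> linarith [hy.1, hy.2]))
      (fun s y hy => hB s y (by
        rw [abs_le] at hy ⊢
        constructor <;> linarith [hy.1, hy.2])) _ h4
    rw [map_mul, map_mul, RelIso.mul_apply, RelIso.mul_apply, ← h3]
    exact ⟨h5, by linarith [h6.1], by linarith [h6.2]⟩

/-- Concatenation of a sequence of actions on the line which coincide near `±∞` with a fixed action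
by translations. -/
theorem exists_concatenation {α : Type*} {τ : α → ℝ} (hτ : ∀ s, |τ s| ≤ 1) (w : FreeGroup α)
    (v : ℕ → α → ℝ ≃o ℝ) (hv : ∀ n, FreeGroup.lift (v n) w = 1)
    (hfix : ∀ n x, ∃ s, v n s x ≠ x)
    (hL : ∀ n, ∃ L, ∀ s x, L ≤ |x| → v n s x = x + τ s) (m : ℕ → ℝ) (hm : ∀ n, 0 ≤ m n) :
    ∃ (u : α → ℝ ≃o ℝ) (t : ℕ → ℝ), FreeGroup.lift u w = 1 ∧ (∀ x, ∃ s, u s x ≠ x) ∧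
      (∀ n s x, |x| ≤ m n → u s (t n + x) = t n + v n s x) ∧
      ∀ n, t n + m n < t (n + 1) - m (n + 1) := by
  classical
  choose L hL using hL
  obtain ⟨k, hk, hw⟩ := exists_forall_mem_Icc_lift_apply_eq hτ w
  -- Block n is [z n, z (n + 1)], of half-length l n. The margin k leaves room for evaluating the
  -- relator across a block boundary while seeing only translations there.
  obtain ⟨l, hl⟩ : ∃ l : ℕ → ℝ, l = fun n => max (L n) (m n) + k + 1 := ⟨_, rfl⟩
  have hlL : ∀ n, L n + k + 1 ≤ l n := fun n => by
    rw [hl]; linarith [le_max_left (L n) (m n)]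
  have hlm : ∀ n, m n + k + 1 ≤ l n := fun n => by
    rw [hl]; linarith [le_max_right (L n) (m n)]
  have hl1 : ∀ n, k + 1 ≤ l n := fun n => by linarith [hlm n, hm n]
  obtain ⟨z, hz⟩ : ∃ z : ℕ → ℝ, ∀ n, z (n + 1) = z n + 2 * l n :=
    ⟨fun n => Nat.rec 0 (fun n z => z + 2 * l n) n, fun n => rfl⟩
  have hzm : Monotone z := monotone_nat_of_le_succ fun n => by linarith [hz n, hl1 n]
  have hzn : ∀ n : ℕ, z 0 + n ≤ z n := by
    intro n
    induction n with
    | zero => simp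
    | succ n ih => push_cast; linarith [hz n, hl1 n]
  have hex : ∀ x, ∃ n, x ≤ z (n + 1) := by
    intro x
    obtain ⟨n, hn⟩ := exists_nat_ge (x - z 0)
    exact ⟨n, by linarith [hzn n, hzm n.le_succ]⟩
  obtain ⟨t, ht⟩ : ∃ t : ℕ → ℝ, t = fun n => z n + l n := ⟨_, rfl⟩
  have htz : ∀ n, z n = t n - l n := fun n => by rw [ht]; ring
  have htz' : ∀ n, z (n + 1) = t n + l n := fun n => by rw [ht, hz]; ring
  have hVex : ∀ n s, ∃ e : ℝ ≃o ℝ, ∀ x, e x = t n + v n s (x - t n) := by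
    intro n s
    have hmono : StrictMono fun x => t n + v n s (x - t n) := fun x y hxy =>
      add_lt_add_right ((v n s).strictMono (sub_lt_sub_right hxy _)) _
    exact ⟨hmono.orderIsoOfSurjective _ fun y =>
      ⟨t n + (v n s).symm (y - t n), by simp⟩, fun x => rfl⟩
  choose V hV using hVex
  have hVstd : ∀ n s x, L n ≤ |x - t n| → V n s x = x + τ s := fun n s x hx => by
    rw [hV, hL n s _ hx]; ring
  have hVz : ∀ n s, V n s (z n) = z n + τ s := fun n s => hVstd n s _ (by
    rw [htz, abs_sub_comm]; refine le_trans ?_ (le_abs_self _); linarith [hlL n])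
  have hVz' : ∀ n s, V n s (z (n + 1)) = z (n + 1) + τ s := fun n s => hVstd n s _ (by
    rw [htz']; refine le_trans ?_ (le_abs_self _); linarith [hlL n])
  -- The index of the block containing x; block 0 is also used all the way to −∞.
  obtain ⟨idx, hidx, hidx'⟩ : ∃ idx : ℝ → ℕ, (∀ x, x ≤ z (idx x + 1)) ∧
      ∀ x n, n < idx x → z (n + 1) < x :=
    ⟨fun x => Nat.find (hex x), fun x => Nat.find_spec (hex x),
      fun x n hn => not_le.1 (Nat.find_min (hex x) hn)⟩
  have hidx_pos : ∀ x n, n < idx x → z (idx x) < x := by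
    intro x n hn
    have := hidx' x (idx x - 1) (by lia)
    rwa [Nat.sub_add_cancel (by lia)] at this
  have hidx_eq : ∀ x n, x ≤ z (n + 1) → (n = 0 ∨ z n < x) → idx x = n := by
    intro x n h1 h2
    rcases lt_trichotomy (idx x) n with h | h | h
    · rcases h2 with h2 | h2
      · lia
      · have h3 : z (idx x + 1) ≤ z n := hzm (by lia)
        linarith [hidx x]
    · exact h
    · linarith [hidx' x n h]
  have hmono : ∀ s, StrictMono fun x => V (idx x) s x := by
    intro s x y hxy
    dsimp only
    rcases lt_trichotomy (idx x) (idx y) with h | h | h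
    · calc V (idx x) s x ≤ V (idx x) s (z (idx x + 1)) := (V _ s).monotone (hidx x)
        _ = z (idx x + 1) + τ s := hVz' _ _
        _ ≤ z (idx y) + τ s := by linarith [hzm (show idx x + 1 ≤ idx y from h)]
        _ = V (idx y) s (z (idx y)) := (hVz _ _).symm
        _ < V (idx y) s y := (V _ s).strictMono (hidx_pos y _ h)
    · rw [h]; exact (V _ s).strictMono hxy
    · have h1 : z (idx y + 1) ≤ z (idx x) := hzm h
      linarith [hidx y, hidx_pos x _ h]
  have hsurj : ∀ s, Function.Surjective fun x => V (idx x) s x := by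
    intro s y
    -- Each generator carries the endpoints of a block to their translates by τ s, so the preimage
    -- of y lies in the block of y - τ s.
    obtain ⟨n, hn⟩ : ∃ n, n = idx (y - τ s) := ⟨_, rfl⟩
    obtain ⟨x, hx⟩ := (V n s).surjective y
    have hxn : idx x = n := by
      refine hidx_eq x n ?_ ?_
      · rw [← (V n s).le_iff_le, hx, hVz']
        have := hidx (y - τ s)
        rw [← hn] at this
        linarith
      · rcases Nat.eq_zero_or_pos n with h0 | h0
        · exact Or.inl h0
        · right
          rw [← (V n s).lt_iff_lt, hx, hVz]
          have := hidx_pos (y - τ s) 0 (hn ▸ h0)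
          rw [← hn] at this
          linarith
    exact ⟨x, by dsimp only; rw [hxn, hx]⟩
  obtain ⟨u, hu⟩ : ∃ u : α → ℝ ≃o ℝ, ∀ s x, u s x = V (idx x) s x :=
    ⟨fun s => (hmono s).orderIsoOfSurjective _ (hsurj s), fun s x => rfl⟩
  have huV : ∀ n s x, (n = 0 ∨ z n - k ≤ x) → x ≤ z (n + 1) + k → u s x = V n s x := by
    intro n s x h1 h2
    rw [hu]
    rcases lt_trichotomy (idx x) n with h | h | h
    · have h3 : z n - k ≤ x := h1.resolve_left (by lia)
      have h4 : z (idx x + 1) ≤ z n := hzm h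
      have h5 := hidx x
      rw [hVstd, hVstd]
      · rw [abs_sub_comm]; refine le_trans ?_ (le_abs_self _)
        linarith [hlL n, htz n]
      · refine le_trans ?_ (le_abs_self _)
        linarith [hlL (idx x), htz' (idx x)]
    · rw [h]
    · have h4 : z (n + 1) ≤ z (idx x) := hzm h
      have h5 := hidx_pos x _ h
      rw [hVstd, hVstd]
      · refine le_trans ?_ (le_abs_self _)
        linarith [hlL n, htz' n]
      · rw [abs_sub_comm]; refine le_trans ?_ (le_abs_self _)
        linarith [hlL (idx x), htz (idx x)]
  have hustd : ∀ n s x, (n = 0 ∨ z n - k ≤ x) → x ≤ z n + k → u s x = x + τ s := by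
    intro n s x h1 h2
    rw [huV n s x h1 (by linarith [hzm n.le_succ]), hVstd]
    rw [abs_sub_comm]; refine le_trans ?_ (le_abs_self _)
    linarith [hlL n, htz n]
  have hVw : ∀ n, FreeGroup.lift (V n) w = 1 := fun n =>
    lift_eq_one_of_semiconj (φ := fun x => x - t n) (fun x y h => by simpa using h)
      (fun s x => by rw [hV]; ring) (hv n)
  refine ⟨u, t, DFunLike.ext _ _ fun x => ?_, fun x => ?_, fun n s x hx => ?_, fun n => ?_⟩
  · obtain ⟨n, hn⟩ : ∃ n, n = idx x := ⟨_, rfl⟩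
    -- In block 0 the point x may lie to the left of z 0, so the left end of the comparison interval
    -- is lowered to reach it.
    obtain ⟨A, hAx, hA⟩ : ∃ A ≤ x, (n = 0 ∧ A ≤ z n) ∨ A = z n := by
      rcases Nat.eq_zero_or_pos n with h0 | h0
      · exact ⟨min x (z n), min_le_left _ _, Or.inl ⟨h0, min_le_right _ _⟩⟩
      · exact ⟨z n, hn ▸ (hidx_pos x 0 (hn ▸ h0)).le, Or.inr rfl⟩
    have hAz : A ≤ z n := by rcases hA with h | h; exacts [h.2, h.le]
    have hA' : n = 0 ∨ z n = A := by rcases hA with h | h; exacts [Or.inl h.1, Or.inr h.symm]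
    have := (hw u (V n) A (z (n + 1)) (fun s y hy => huV n s y
      (hA'.imp_right fun h => by rw [h]; exact hy.1) hy.2) (fun s y hy => by
        rw [abs_le] at hy
        exact hustd n s y (hA'.imp_right fun h => by rw [h]; linarith [hy.1])
          (by linarith [hy.2])) (fun s y hy => by
        rw [abs_le] at hy
        exact hustd (n + 1) s y (Or.inr (by linarith [hy.1])) (by linarith [hy.2])) x
      ⟨hAx, hn ▸ hidx x⟩).1
    rw [this, hVw]
  · obtain ⟨s, hs⟩ := hfix (idx x) (x - t (idx x))
    refine ⟨s, fun h => hs ?_⟩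
    rw [hu, hV] at h
    linarith
  · rw [abs_le] at hx
    rw [huV n s _ (Or.inr (by linarith [htz n, hlm n, hx.1]))
      (by linarith [htz' n, hlm n, hx.2]), hV, add_sub_cancel_left]
  · linarith [htz' n, htz (n + 1), hlm n, hlm (n + 1)]

theorem abs_standardShift_le (n : ℕ) (s) : |standardShift n s| ≤ 1 := by
  unfold standardShift
  split_ifs <;> simp

/-- Two actions without global fixed points can be glued to an action without global fixed points
that follows the first one to the left of `w₁` and the second one to the right of `w₂`. -/
theorem exists_glue_actions {n : ℕ} {v₁ v₂ : Fin (n + 2) ⊕ Fin (n + 2) → ℝ ≃o ℝ}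
    (h₁ : FreeGroup.lift v₁ (surfaceRelator (n + 2)) = 1) (hf₁ : ∀ x, ∃ s, v₁ s x ≠ x)
    (h₂ : FreeGroup.lift v₂ (surfaceRelator (n + 2)) = 1) (hf₂ : ∀ x, ∃ s, v₂ s x ≠ x)
    {w₁ w₂ : ℝ} (hw : w₁ < w₂) (M : ℝ) :
    ∃ u : Fin (n + 2) ⊕ Fin (n + 2) → ℝ ≃o ℝ,
      FreeGroup.lift u (surfaceRelator (n + 2)) = 1 ∧ (∀ x, ∃ s, u s x ≠ x) ∧
      (∀ s x, -M ≤ x → x ≤ w₁ → v₁ s x ≤ w₁ → u s x = v₁ s x) ∧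
      ∀ s x, w₂ ≤ x → x ≤ M → w₂ ≤ v₂ s x → u s x = v₂ s x := by
  obtain ⟨K, hKM, hK₁, hK₂⟩ : ∃ K, M ≤ K ∧ |w₁| ≤ K ∧ |w₂| ≤ K :=
    ⟨max M (max |w₁| |w₂|), le_max_left _ _, (le_max_left |w₁| _).trans (le_max_right _ _),
      (le_max_right _ |w₂|).trans (le_max_right _ _)⟩
  have hK0 : 0 ≤ K := (abs_nonneg _).trans hK₁
  rw [abs_le] at hK₁ hK₂
  obtain ⟨p, hp, hpf, hpv, hpL⟩ := exists_standard v₁ h₁ hf₁ K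
  obtain ⟨r, hr, hrf, hrv, hrL⟩ := exists_standard v₂ h₂ hf₂ K
  obtain ⟨u₀, t, hu₀, hu₀f, hu₀v, ht⟩ := exists_concatenation (abs_standardShift_le n)
    (surfaceRelator (n + 2)) (fun i => if i = 0 then p else r)
    (fun i => by split_ifs <;> assumption)
    (fun i => by split_ifs <;> assumption)
    (fun i => by split_ifs <;> assumption) (fun _ => K) (fun _ => hK0)
  obtain ⟨g₁, hg₁⟩ := OrderIso.exists_affine one_pos (-t 0)
  obtain ⟨g₂, hg₂⟩ := OrderIso.exists_affine one_pos (-t 1)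
  -- Conjugating by h undoes the translation by t 0 on the left and by t 1 on the right, squeezing
  -- the transition region into (w₁, w₂).
  obtain ⟨h, hh₁, hh₂⟩ := OrderIso.exists_interpolate g₁ g₂ (p := t 0 + w₁) (q := t 1 + w₂)
    (by linarith [ht 0]) (by rw [hg₁, hg₂]; linarith)
  have hh₁' : ∀ x ≤ w₁, h (t 0 + x) = x := fun x hx => by
    rw [hh₁ _ (by linarith), hg₁]; ring
  have hh₂' : ∀ x, w₂ ≤ x → h (t 1 + x) = x := fun x hx => by
    rw [hh₂ _ (by linarith), hg₂]; ring
  refine ⟨fun s => h * u₀ s * h⁻¹, ?_, fun x => ?_, fun s x hx hx' hx'' => ?_,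
    fun s x hx hx' hx'' => ?_⟩
  · exact lift_eq_one_of_semiconj (φ := fun x => h⁻¹ x) (fun x y hxy => h⁻¹.injective hxy)
      (fun s x => by simp only [RelIso.mul_apply, RelIso.inv_apply_self]) hu₀
  · obtain ⟨s, hs⟩ := hu₀f (h⁻¹ x)
    refine ⟨s, fun he => hs ?_⟩
    rw [← h.injective.eq_iff, RelIso.apply_inv_self]
    exact he
  · have h1 : h⁻¹ x = t 0 + x := by
      rw [← h.injective.eq_iff, RelIso.apply_inv_self, hh₁' x hx']
    have h2 : |x| ≤ K := abs_le.2 ⟨by linarith, by linarith⟩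
    have h3 := hu₀v 0 s x h2
    simp only [if_true, hpv s x h2] at h3
    simp only [RelIso.mul_apply]
    rw [h1, h3, hh₁' _ hx'']
  · have h1 : h⁻¹ x = t 1 + x := by
      rw [← h.injective.eq_iff, RelIso.apply_inv_self, hh₂' x hx]
    have h2 : |x| ≤ K := abs_le.2 ⟨by linarith, by linarith⟩
    have h3 := hu₀v 1 s x h2
    simp only [one_ne_zero, if_false, hrv s x h2] at h3
    simp only [RelIso.mul_apply]
    rw [h1, h3, hh₂' _ hx'']

/-! ### Removing global fixed points -/

/-- A half-line is order isomorphic to the line, by a map which is the identity on `(-∞, K]`. -/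
theorem exists_strictMono_range_eq_Iio {K β : ℝ} (h : K < β) :
    ∃ φ : ℝ → ℝ, StrictMono φ ∧ range φ = Iio β ∧ ∀ x ≤ K, φ x = x := by
  classical
  obtain ⟨d, hd⟩ : ∃ d, d = β - K := ⟨_, rfl⟩
  have hd0 : 0 < d := by linarith
  have key : ∀ x, K < x → K < β - d ^ 2 / (d + (x - K)) := fun x hx => by
    have h1 : d ^ 2 / (d + (x - K)) < d := by
      rw [div_lt_iff₀ (by linarith)]; nlinarith
    linarith
  -- The second branch is a Möbius map with value K at K and limit β at +∞.
  refine ⟨fun x => if x ≤ K then x else β - d ^ 2 / (d + (x - K)), ?_, ?_, fun x hx => if_pos hx⟩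
  · intro x y hxy
    dsimp only
    split_ifs with h1 h2 h2
    · exact hxy
    · exact h1.trans_lt (key y (not_le.1 h2))
    · exact absurd (hxy.le.trans h2) h1
    · have : d ^ 2 / (d + (y - K)) < d ^ 2 / (d + (x - K)) :=
        div_lt_div_of_pos_left (by positivity) (by linarith) (by linarith)
      linarith
  · ext y
    constructor
    · rintro ⟨x, rfl⟩
      dsimp only
      split_ifs with h1
      · exact h1.trans_lt h
      · have : 0 < d ^ 2 / (d + (x - K)) := div_pos (by positivity) (by linarith)
        exact mem_Iio.2 (by linarith)
    · intro hy
      rw [mem_Iio] at hy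
      rcases le_or_gt y K with h1 | h1
      · exact ⟨y, if_pos h1⟩
      · have h2 : 0 < β - y := by linarith
        have h3 : 1 < d / (β - y) := by rw [one_lt_div h2]; linarith
        refine ⟨K + d * (d / (β - y) - 1), ?_⟩
        have h4 : 0 < d * (d / (β - y) - 1) := mul_pos hd0 (by linarith)
        dsimp only
        have h5 : d + (K + d * (d / (β - y) - 1) - K) = d ^ 2 / (β - y) := by ring
        rw [if_neg (by linarith), h5, div_div_cancel₀ (by positivity)]
        ring

/-- The first global fixed point β at or beyond c is sent to +∞: the half-line (-∞, β) is invariant,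
and the restricted action is transported to the whole line. -/
theorem exists_no_fixed_point_right {α : Type*} [Finite α] {w : FreeGroup α} {v : α → ℝ ≃o ℝ}
    (hv : FreeGroup.lift v w = 1) {c d : ℝ} (hcd : c ≤ d)
    (hfix : ∀ x ∈ Icc c d, ∃ s, v s x ≠ x) :
    ∃ u : α → ℝ ≃o ℝ, FreeGroup.lift u w = 1 ∧ (∀ x, c ≤ x → ∃ s, u s x ≠ x) ∧
      ∀ s, ∀ x ≤ d, u s x = v s x := by
  by_cases hF : ∃ x, c ≤ x ∧ ∀ s, v s x = x
  swap
  · push Not at hF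
    exact ⟨v, hv, hF, fun s x _ => rfl⟩
  obtain ⟨F, hFdef⟩ : ∃ F : Set ℝ, F = {x | c ≤ x ∧ ∀ s, v s x = x} := ⟨_, rfl⟩
  have hFc : IsClosed F := by
    have : F = Ici c ∩ ⋂ s, {x | v s x = x} := by ext; simp [hFdef]
    rw [this]
    exact isClosed_Ici.inter (isClosed_iInter fun s => isClosed_eq (v s).continuous continuous_id)
  have hFb : BddBelow F := ⟨c, fun x hx => by rw [hFdef] at hx; exact hx.1⟩
  have hβF : sInf F ∈ F := hFc.csInf_mem (by rw [hFdef]; exact hF) hFb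
  obtain ⟨β, hβ⟩ : ∃ β, β = sInf F := ⟨_, rfl⟩
  rw [← hβ, hFdef] at hβF
  obtain ⟨hcβ, hβfix⟩ := hβF
  have hlt : ∀ x, c ≤ x → x < β → ∃ s, v s x ≠ x := by
    intro x h1 h2
    by_contra! h3
    have : β ≤ x := hβ ▸ csInf_le hFb (by rw [hFdef]; exact ⟨h1, h3⟩)
    linarith
  have hdβ : d < β := by
    by_contra! h
    obtain ⟨s, hs⟩ := hfix β ⟨hcβ, h⟩
    exact hs (hβfix s)
  have hvβ : ∀ s x, v s x < β ↔ x < β := fun s x => by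
    conv_lhs => rw [← hβfix s]
    exact (v s).lt_iff_lt
  -- With K above d and above all v s d, the identification φ is the identity on (-∞, d] and on its
  -- images under the generators.
  obtain ⟨K, hKd, hKβ, hKv⟩ : ∃ K, d ≤ K ∧ K < β ∧ ∀ s, v s d ≤ K := by
    have h1 : ∀ᶠ K in 𝓝[<] β, d ≤ K :=
      mem_nhdsWithin_of_mem_nhds (Ici_mem_nhds hdβ)
    have h2 : ∀ᶠ K in 𝓝[<] β, ∀ s, v s d ≤ K := eventually_all.2 fun s =>
      mem_nhdsWithin_of_mem_nhds (Ici_mem_nhds ((hvβ s d).2 hdβ))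
    have h3 : ∀ᶠ K in 𝓝[<] β, K < β := eventually_mem_nhdsWithin
    obtain ⟨K, hK⟩ := (h1.and (h3.and h2)).exists
    exact ⟨K, hK⟩
  obtain ⟨φ, hφm, hφr, hφK⟩ := exists_strictMono_range_eq_Iio hKβ
  have hφβ : ∀ x, φ x < β := fun x => by
    have : φ x ∈ range φ := ⟨x, rfl⟩
    rwa [hφr] at this
  have hφs : ∀ y, y < β → ∃ x, φ x = y := fun y hy => by
    have : y ∈ range φ := by rw [hφr]; exact hy
    exact this
  choose g hg using fun s x => hφs (v s (φ x)) ((hvβ s _).2 (hφβ x))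
  have hgm : ∀ s, StrictMono (g s) := fun s x y hxy => by
    rw [← hφm.lt_iff_lt, hg, hg, (v s).lt_iff_lt]
    exact hφm hxy
  have hgs : ∀ s, Function.Surjective (g s) := by
    intro s y
    obtain ⟨x, hx⟩ := hφs ((v s)⁻¹ (φ y)) (by
      rw [← hvβ s, RelIso.apply_inv_self]; exact hφβ y)
    exact ⟨x, hφm.injective (by rw [hg, hx, RelIso.apply_inv_self])⟩
  obtain ⟨u, hu⟩ : ∃ u : α → ℝ ≃o ℝ, ∀ s x, u s x = g s x :=
    ⟨fun s => (hgm s).orderIsoOfSurjective _ (hgs s), fun s x => rfl⟩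
  refine ⟨u, lift_eq_one_of_semiconj hφm.injective (fun s x => by rw [hu, hg]) hv,
    fun x hx => ?_, fun s x hx => ?_⟩
  · obtain ⟨s, hs⟩ := hlt (φ x) (by
      rcases le_total x K with h1 | h1
      · rwa [hφK x h1]
      · calc c ≤ K := hcd.trans hKd
          _ = φ K := (hφK K le_rfl).symm
          _ ≤ φ x := hφm.monotone h1) (hφβ x)
    exact ⟨s, fun h => hs (by rw [← hg, ← hu, h])⟩
  · apply hφm.injective
    rw [hu, hg, hφK x (hx.trans hKd), hφK _ (((v s).monotone hx).trans (hKv s))]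

theorem exists_no_fixed_point_of_Icc {α : Type*} [Finite α] {w : FreeGroup α} {v : α → ℝ ≃o ℝ}
    (hv : FreeGroup.lift v w = 1) {c d : ℝ} (hcd : c ≤ d)
    (hfix : ∀ x ∈ Icc c d, ∃ s, v s x ≠ x) :
    ∃ u : α → ℝ ≃o ℝ, FreeGroup.lift u w = 1 ∧ (∀ x, ∃ s, u s x ≠ x) ∧
      ∀ s, ∀ x ∈ Icc c d, u s x = v s x := by
  obtain ⟨u₁, h₁, h₁f, h₁v⟩ := exists_no_fixed_point_right hv hcd hfix
  choose r hr using fun s => OrderIso.exists_reflect (u₁ s)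
  obtain ⟨u₂, h₂, h₂f, h₂v⟩ := exists_no_fixed_point_right (v := r) (c := -d) (d := -c)
    (lift_eq_one_of_semiconj neg_injective (fun s x => by rw [hr, neg_neg]) h₁) (by linarith)
    (fun x hx => by
      obtain ⟨s, hs⟩ := h₁f (-x) (by linarith [hx.2])
      exact ⟨s, fun h => hs (by rw [hr] at h; linarith)⟩)
  choose u hu using fun s => OrderIso.exists_reflect (u₂ s)
  have hu₁ : ∀ s x, c ≤ x → u s x = u₁ s x := fun s x hx => by
    rw [hu, h₂v s (-x) (by linarith), hr, neg_neg, neg_neg]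
  refine ⟨u, lift_eq_one_of_semiconj neg_injective (fun s x => by rw [hu, neg_neg]) h₂,
    fun x => ?_, fun s x hx => ?_⟩
  · rcases le_total c x with h | h
    · obtain ⟨s, hs⟩ := h₁f x h
      exact ⟨s, by rwa [hu₁ s x h]⟩
    · obtain ⟨s, hs⟩ := h₂f (-x) (by linarith)
      exact ⟨s, fun h => hs (by rw [hu] at h; linarith)⟩
  · rw [hu₁ s x hx.1, h₁v s x hx.2]

theorem exists_small_translation (n : ℕ) {ε : ℝ} (hε : 0 < ε) :
    ∃ u : Fin (n + 2) ⊕ Fin (n + 2) → ℝ ≃o ℝ,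
      FreeGroup.lift u (surfaceRelator (n + 2)) = 1 ∧ (∀ x, ∃ s, u s x ≠ x) ∧
      ∀ s x, |u s x - x| < ε := by
  choose u hu using fun s => OrderIso.exists_affine one_pos (standardShift n s * (ε / 2))
  refine ⟨u, ?_, fun x => ⟨Sum.inl 1, ?_⟩, fun s x => ?_⟩
  · rw [lift_surfaceRelator]
    refine List.prod_eq_one fun x hx => ?_
    rw [List.mem_ofFn] at hx
    obtain ⟨i, rfl⟩ := hx
    have : u (Sum.inr i) = 1 := DFunLike.ext _ _ fun x => by rw [hu]; simp [standardShift]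
    dsimp only
    rw [this, commutatorElement_one_right]
  · rw [hu]
    simp [standardShift, hε.ne']
  · rw [hu, one_mul, add_sub_cancel_left, abs_mul, abs_of_pos (half_pos hε)]
    nlinarith [abs_standardShift_le n s]

/-- Any action of a surface group on the line is pointwise approximated, on finitely many generic
points, by actions without global fixed points. -/
theorem exists_no_fixed_point_near {n : ℕ} {v : Fin (n + 2) ⊕ Fin (n + 2) → ℝ ≃o ℝ}
    (hv : FreeGroup.lift v (surfaceRelator (n + 2)) = 1) (X : Finset ℝ)
    (hX : ∀ x ∈ X, (∃ s, v s x ≠ x) ∨ ∀ᶠ y in 𝓝 x, ∀ s, v s y = y) {ε : ℝ} (hε : 0 < ε) :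
    ∃ u : Fin (n + 2) ⊕ Fin (n + 2) → ℝ ≃o ℝ,
      FreeGroup.lift u (surfaceRelator (n + 2)) = 1 ∧ (∀ x, ∃ s, u s x ≠ x) ∧
      ∀ x ∈ X, ∀ s, |u s x - v s x| < ε := by
  classical
  induction hN : X.card using Nat.strong_induction_on generalizing X ε with
  | _ N ih =>
  subst hN
  by_cases hsep : ∃ p, p ∉ X ∧ (∀ s, v s p = p) ∧ (∃ x ∈ X, x < p) ∧ ∃ x ∈ X, p < x
  · obtain ⟨p, hpX, hp, ⟨x₁, hx₁, hx₁p⟩, x₂, hx₂, hx₂p⟩ := hsep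
    have hlt : ∀ s x, x < p → v s x < p := fun s x hx => by
      rw [← hp s]; exact (v s).strictMono hx
    have hgt : ∀ s x, p < x → p < v s x := fun s x hx => by
      conv_lhs => rw [← hp s]
      exact (v s).strictMono hx
    obtain ⟨w₁, hw₁p, hw₁⟩ : ∃ w₁, w₁ < p ∧ ∀ x ∈ X.filter (· < p), x < w₁ ∧ ∀ s, v s x < w₁ := by
      have h1 : ∀ᶠ w in 𝓝[<] p, ∀ x ∈ X.filter (· < p), x < w ∧ ∀ s, v s x < w := by
        rw [Finset.eventually_all]
        intro x hx
        have hx' := (Finset.mem_filter.1 hx).2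
        refine Eventually.and (mem_nhdsWithin_of_mem_nhds (Ioi_mem_nhds hx')) (eventually_all.2 fun s =>
          mem_nhdsWithin_of_mem_nhds (Ioi_mem_nhds (hlt s x hx')))
      have h2 : ∀ᶠ w in 𝓝[<] p, w < p := eventually_mem_nhdsWithin
      exact (h2.and h1).exists
    obtain ⟨w₂, hw₂p, hw₂⟩ : ∃ w₂, p < w₂ ∧ ∀ x ∈ X.filter (p < ·), w₂ < x ∧ ∀ s, w₂ < v s x := by
      have h1 : ∀ᶠ w in 𝓝[>] p, ∀ x ∈ X.filter (p < ·), w < x ∧ ∀ s, w < v s x := by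
        rw [Finset.eventually_all]
        intro x hx
        have hx' := (Finset.mem_filter.1 hx).2
        refine Eventually.and (mem_nhdsWithin_of_mem_nhds (Iio_mem_nhds hx')) (eventually_all.2 fun s =>
          mem_nhdsWithin_of_mem_nhds (Iio_mem_nhds (hgt s x hx')))
      have h2 : ∀ᶠ w in 𝓝[>] p, p < w := eventually_mem_nhdsWithin
      exact (h2.and h1).exists
    -- The tolerance e is so small that approximate images of points of X stay on their side of w₁
    -- or w₂, as the gluing requires.
    obtain ⟨e, he0, heε, he₁, he₂⟩ : ∃ e, 0 < e ∧ e ≤ ε ∧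
        (∀ x ∈ X.filter (· < p), ∀ s, e < w₁ - v s x) ∧
        ∀ x ∈ X.filter (p < ·), ∀ s, e < v s x - w₂ := by
      have h0 : ∀ᶠ e in 𝓝[>] (0 : ℝ), 0 < e := eventually_mem_nhdsWithin
      have h1 : ∀ᶠ e in 𝓝[>] (0 : ℝ), e ≤ ε := mem_nhdsWithin_of_mem_nhds (Iic_mem_nhds hε)
      have h2 : ∀ᶠ e in 𝓝[>] (0 : ℝ), ∀ x ∈ X.filter (· < p), ∀ s, e < w₁ - v s x := by
        rw [Finset.eventually_all]
        exact fun x hx => eventually_all.2 fun s => mem_nhdsWithin_of_mem_nhds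
          (Iio_mem_nhds (sub_pos.2 ((hw₁ x hx).2 s)))
      have h3 : ∀ᶠ e in 𝓝[>] (0 : ℝ), ∀ x ∈ X.filter (p < ·), ∀ s, e < v s x - w₂ := by
        rw [Finset.eventually_all]
        exact fun x hx => eventually_all.2 fun s => mem_nhdsWithin_of_mem_nhds
          (Iio_mem_nhds (sub_pos.2 ((hw₂ x hx).2 s)))
      exact (h0.and (h1.and (h2.and h3))).exists
    obtain ⟨u₁, h₁, h₁f, h₁v⟩ := ih (X.filter (· < p)).card (Finset.card_lt_card (Finset.filter_ssubset.2
      ⟨x₂, hx₂, not_lt.2 hx₂p.le⟩)) (X.filter (· < p))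
      (fun x hx => hX x (Finset.mem_filter.1 hx).1) he0 rfl
    obtain ⟨u₂, h₂, h₂f, h₂v⟩ := ih (X.filter (p < ·)).card (Finset.card_lt_card (Finset.filter_ssubset.2
      ⟨x₁, hx₁, not_lt.2 hx₁p.le⟩)) (X.filter (p < ·))
      (fun x hx => hX x (Finset.mem_filter.1 hx).1) he0 rfl
    obtain ⟨M, hM⟩ : ∃ M, ∀ x ∈ X, |x| ≤ M := by
      have : ∀ᶠ M in (atTop : Filter ℝ), ∀ x ∈ X, |x| ≤ M := by
        rw [Finset.eventually_all]
        exact fun x _ => eventually_ge_atTop _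
      exact this.exists
    obtain ⟨u, hu, huf, huv₁, huv₂⟩ := exists_glue_actions h₁ h₁f h₂ h₂f (hw₁p.trans hw₂p) M
    refine ⟨u, hu, huf, fun x hx s => ?_⟩
    have hxM := abs_le.1 (hM x hx)
    rcases lt_trichotomy x p with h | h | h
    · have hx' : x ∈ X.filter (· < p) := Finset.mem_filter.2 ⟨hx, h⟩
      have h3 := h₁v x hx' s
      have h4 := he₁ x hx' s
      rw [huv₁ s x hxM.1 (hw₁ x hx').1.le (by linarith [(abs_lt.1 h3).2])]
      exact h3.trans_le heε
    · exact absurd (h ▸ hx) hpX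
    · have hx' : x ∈ X.filter (p < ·) := Finset.mem_filter.2 ⟨hx, h⟩
      have h3 := h₂v x hx' s
      have h4 := he₂ x hx' s
      rw [huv₂ s x (hw₂ x hx').1.le hxM.2 (by linarith [(abs_lt.1 h3).1])]
      exact h3.trans_le heε
  -- From here on, every global fixed point strictly between two points of X belongs to X.
  push Not at hsep
  rcases X.eq_empty_or_nonempty with rfl | hne
  · obtain ⟨u, hu, huf, -⟩ := exists_small_translation n hε
    exact ⟨u, hu, huf, by simp⟩
  by_cases hfix : ∀ x ∈ Icc (X.min' hne) (X.max' hne), ∃ s, v s x ≠ x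
  · obtain ⟨u, hu, huf, huv⟩ := exists_no_fixed_point_of_Icc hv (X.min'_le _ (X.max'_mem hne)) hfix
    refine ⟨u, hu, huf, fun x hx s => ?_⟩
    rw [huv s x ⟨X.min'_le x hx, X.le_max' x hx⟩]
    simpa using hε
  push Not at hfix
  obtain ⟨p, hpI, hp⟩ := hfix
  have hpX : p ∈ X := by
    by_contra h
    have h1 : X.min' hne < p := lt_of_le_of_ne hpI.1 fun h' => h (h' ▸ X.min'_mem hne)
    have h2 : p < X.max' hne := lt_of_le_of_ne hpI.2 fun h' => h (h' ▸ X.max'_mem hne)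
    exact (hsep p h hp ⟨_, X.min'_mem hne, h1⟩ _ (X.max'_mem hne)).not_gt h2
  have hpint := (hX p hpX).resolve_left (by simpa using hp)
  obtain ⟨δ, hδ, hball⟩ := Metric.eventually_nhds_iff.1 hpint
  -- All points near p are global fixed points, so one of them outside X would separate p from any
  -- other point of X. This is why frontier points of the fixed set are excluded.
  have hsub : ∀ x ∈ X, x = p := by
    intro y hy
    rcases lt_trichotomy y p with h | h | h
    · obtain ⟨z, hz, hzX⟩ := (Ioo_infinite (max_lt h (sub_lt_self p hδ))).exists_notMem_finset X
      have h1 : y < z := (le_max_left _ _).trans_lt hz.1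
      have h2 : p - δ < z := (le_max_right _ _).trans_lt hz.1
      exact absurd hz.2 (hsep z hzX (hball (by
        rw [Real.dist_eq, abs_lt]; constructor <;> linarith [hz.2])) ⟨y, hy, h1⟩ p hpX).not_gt
    · exact h
    · obtain ⟨z, hz, hzX⟩ :=
        (Ioo_infinite (lt_min h (lt_add_of_pos_right p hδ))).exists_notMem_finset X
      have h1 : z < y := hz.2.trans_le (min_le_left _ _)
      have h2 : z < p + δ := hz.2.trans_le (min_le_right _ _)
      exact absurd h1 (hsep z hzX (hball (by
        rw [Real.dist_eq, abs_lt]; constructor <;> linarith [hz.1])) ⟨p, hpX, hz.1⟩ y hy).not_gt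
  obtain ⟨u, hu, huf, huv⟩ := exists_small_translation n hε
  refine ⟨u, hu, huf, fun x hx s => ?_⟩
  rw [hsub x hx, hp s]
  exact huv s p

/-! ### Convergence in the spaces of homeomorphisms and representations -/

namespace HomeoPlus

theorem apply_symm_apply (f : HomeoPlus) (x : ℝ) : f.1 (f.1.symm x) = x := f.1.apply_symm_apply x

theorem strictMono (f : HomeoPlus) : StrictMono f.1 := f.2

/-- Pointwise convergence on a dense set of increasing homeomorphisms is continuous convergence. -/
theorem tendsto_apply_of_dense {ι : Type*} {l : Filter ι} {F : ι → HomeoPlus} {f : HomeoPlus}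
    {D : Set ℝ} (hD : Dense D) (h : ∀ x ∈ D, Tendsto (fun i => (F i).1 x) l (𝓝 (f.1 x)))
    {y : ι → ℝ} {z : ℝ} (hy : Tendsto y l (𝓝 z)) :
    Tendsto (fun i => (F i).1 (y i)) l (𝓝 (f.1 z)) := by
  rw [tendsto_order]
  constructor
  · intro a ha
    obtain ⟨u, huD, hu⟩ := hD.exists_between (show f.1.symm a < z by
      rwa [← (strictMono f).lt_iff_lt, apply_symm_apply])
    have h1 : a < f.1 u := by
      rw [← apply_symm_apply f a]; exact strictMono f hu.1
    filter_upwards [(h u huD).eventually_const_lt h1, hy.eventually_const_lt hu.2] with i h2 h3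
    exact h2.trans (strictMono (F i) h3)
  · intro a ha
    obtain ⟨u, huD, hu⟩ := hD.exists_between (show z < f.1.symm a by
      rwa [← (strictMono f).lt_iff_lt, apply_symm_apply])
    have h1 : f.1 u < a := by
      conv_rhs => rw [← apply_symm_apply f a]
      exact strictMono f hu.2
    filter_upwards [(h u huD).eventually_lt_const h1, hy.eventually_lt_const hu.1] with i h2 h3
    exact (strictMono (F i) h3).trans h2

theorem tendsto_inv_apply {ι : Type*} {l : Filter ι} {F : ι → HomeoPlus} {f : HomeoPlus}
    (h : ∀ x, Tendsto (fun i => (F i).1 x) l (𝓝 (f.1 x))) (x : ℝ) :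
    Tendsto (fun i => (F i)⁻¹.1 x) l (𝓝 (f⁻¹.1 x)) := by
  change Tendsto (fun i => (F i).1.symm x) l (𝓝 (f.1.symm x))
  rw [tendsto_order]
  constructor
  · intro a ha
    have h1 : f.1 a < x := by rw [← apply_symm_apply f x]; exact strictMono f ha
    filter_upwards [(h a).eventually_lt_const h1] with i hi
    rwa [← (strictMono (F i)).lt_iff_lt, apply_symm_apply]
  · intro a ha
    have h1 : x < f.1 a := by
      conv_lhs => rw [← apply_symm_apply f x]
      exact strictMono f ha
    filter_upwards [(h a).eventually_const_lt h1] with i hi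
    rwa [← (strictMono (F i)).lt_iff_lt, apply_symm_apply]

/-- Monotonicity traps the values on a small interval between those at its endpoints; finitely many
such intervals cover a compact set. -/
theorem tendsto_nhds_of_forall {ι : Type*} {l : Filter ι} {F : ι → HomeoPlus} {f : HomeoPlus}
    (h : ∀ x, Tendsto (fun i => (F i).1 x) l (𝓝 (f.1 x))) : Tendsto F l (𝓝 f) := by
  rw [nhds_induced, tendsto_comap_iff, ContinuousMap.tendsto_nhds_compactOpen]
  intro K hK U hU hKU
  refine hK.induction_on (p := fun K => ∀ᶠ i in l, MapsTo (F i).1 K U) ?_ ?_ ?_ ?_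
  · exact Eventually.of_forall fun _ => Set.mapsTo_empty _ _
  · intro s t hst ht
    filter_upwards [ht] with i hi using hi.mono_left hst
  · intro s t hs ht
    filter_upwards [hs, ht] with i h1 h2 using h1.union h2
  · intro x hx
    obtain ⟨a, b, hab, hsub⟩ := mem_nhds_iff_exists_Ioo_subset.1 (hU.mem_nhds (hKU hx))
    change f.1 x ∈ Ioo a b at hab
    have hc : ContinuousAt f.1 x := f.1.continuous.continuousAt
    obtain ⟨p, q, hpq, hsub'⟩ := mem_nhds_iff_exists_Ioo_subset.1
      (hc.preimage_mem_nhds (Ioo_mem_nhds hab.1 hab.2))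
    obtain ⟨u, hpu, hux⟩ := exists_between hpq.1
    obtain ⟨v, hxv, hvq⟩ := exists_between hpq.2
    have hu : a < f.1 u := (hsub' ⟨hpu, hux.trans hpq.2⟩).1
    have hv : f.1 v < b := (hsub' ⟨hpq.1.trans hxv, hvq⟩).2
    refine ⟨Ioo u v, mem_nhdsWithin_of_mem_nhds (Ioo_mem_nhds hux hxv), ?_⟩
    filter_upwards [(h u).eventually_const_lt hu, (h v).eventually_lt_const hv] with i h1 h2
    intro y hy
    exact hsub ⟨h1.trans (strictMono (F i) hy.1), (strictMono (F i) hy.2).trans h2⟩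

instance : SecondCountableTopology HomeoPlus :=
  TopologicalSpace.secondCountableTopology_induced HomeoPlus C(ℝ, ℝ) _

/-- An order automorphism of the line as an orientation preserving homeomorphism. -/
def ofOrderIso : (ℝ ≃o ℝ) →* HomeoPlus where
  toFun f := ⟨f.toHomeomorph, f.strictMono⟩
  map_one' := rfl
  map_mul' _ _ := rfl

theorem exists_ofOrderIso_eq (f : HomeoPlus) : ∃ e, ofOrderIso e = f :=
  ⟨(strictMono f).orderIsoOfSurjective f.1 f.1.surjective, Subtype.ext (Homeomorph.ext fun _ => rfl)⟩

theorem ofOrderIso_injective : Function.Injective ofOrderIso := fun _ _ h =>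
  DFunLike.ext _ _ fun x => congrArg (fun k : HomeoPlus => k.1 x) h

theorem ofOrderIso_apply (f : ℝ ≃o ℝ) (x : ℝ) : (ofOrderIso f).1 x = f x := rfl

end HomeoPlus

namespace LineRep

/-- Reduces convergence of representations to generators and a dense set of points. Products are
handled by evaluating at convergent arguments, inverses by monotonicity. -/
theorem tendsto_nhds_of_forall_mem {Γ : Type*} [Group Γ] {S : Set Γ}
    (hS : Subgroup.closure S = ⊤) {ι : Type*} {l : Filter ι} {F : ι → LineRep Γ} {ρ : LineRep Γ}
    {D : Set ℝ} (hD : Dense D)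
    (h : ∀ s ∈ S, ∀ x ∈ D, Tendsto (fun i => (F i s).1 x) l (𝓝 ((ρ s).1 x))) :
    Tendsto F l (𝓝 ρ) := by
  rw [nhds_induced, tendsto_comap_iff, tendsto_pi_nhds]
  intro g
  refine HomeoPlus.tendsto_nhds_of_forall ?_
  have hg : g ∈ Subgroup.closure S := hS ▸ Subgroup.mem_top g
  induction hg using Subgroup.closure_induction with
  | mem s hs => exact fun x => HomeoPlus.tendsto_apply_of_dense hD (h s hs) tendsto_const_nhds
  | one => intro x; simp only [Function.comp_apply, map_one]; exact tendsto_const_nhds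
  | mul a b _ _ ha hb =>
    intro x
    simp only [Function.comp_apply, map_mul]
    exact HomeoPlus.tendsto_apply_of_dense dense_univ (fun y _ => ha y) (hb x)
  | inv a _ ha =>
    intro x
    simp only [Function.comp_apply, map_inv]
    exact HomeoPlus.tendsto_inv_apply ha x

/-- Makes the set of standard actions separable, so that a single sequence of them is enough to
concatenate. -/
instance {Γ : Type*} [Group Γ] [Countable Γ] : SecondCountableTopology (LineRep Γ) :=
  TopologicalSpace.secondCountableTopology_induced (LineRep Γ) (Γ → HomeoPlus) _

end LineRep

/-! ### Density of standard actions and the theorem -/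

namespace SurfaceGroup

instance (q : ℕ) : Countable (SurfaceGroup q) :=
  (PresentedGroup.mk_surjective {surfaceRelator q}).countable

/-- The action of the surface group on the line in which the generators act by given maps. -/
def lineRep {q : ℕ} (v : Fin q ⊕ Fin q → ℝ ≃o ℝ)
    (hv : FreeGroup.lift v (surfaceRelator q) = 1) : LineRep (SurfaceGroup q) :=
  PresentedGroup.toGroup (f := fun s => HomeoPlus.ofOrderIso (v s)) (by
    rintro r rfl
    have : (HomeoPlus.ofOrderIso.comp (FreeGroup.lift v)) (surfaceRelator q) =
        FreeGroup.lift (fun s => HomeoPlus.ofOrderIso (v s)) (surfaceRelator q) :=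
      FreeGroup.lift_unique _ fun s => by simp
    rw [← this, MonoidHom.comp_apply, hv, map_one])

theorem lineRep_of {q : ℕ} (v : Fin q ⊕ Fin q → ℝ ≃o ℝ)
    (hv : FreeGroup.lift v (surfaceRelator q) = 1) (s) :
    lineRep v hv (PresentedGroup.of s) = HomeoPlus.ofOrderIso (v s) :=
  PresentedGroup.toGroup.of _

theorem exists_lineRep_eq {q : ℕ} (ρ : LineRep (SurfaceGroup q)) :
    ∃ v hv, lineRep v hv = ρ := by
  choose v hv using fun s => HomeoPlus.exists_ofOrderIso_eq (ρ (PresentedGroup.of s))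
  have hrel : FreeGroup.lift v (surfaceRelator q) = 1 := by
    apply HomeoPlus.ofOrderIso_injective
    have h1 : (HomeoPlus.ofOrderIso.comp (FreeGroup.lift v)) (surfaceRelator q) =
        FreeGroup.lift (fun s => ρ (PresentedGroup.of s)) (surfaceRelator q) :=
      FreeGroup.lift_unique _ fun s => by simp [hv]
    have h2 : (ρ.comp (PresentedGroup.mk {surfaceRelator q})) (surfaceRelator q) =
        FreeGroup.lift (fun s => ρ (PresentedGroup.of s)) (surfaceRelator q) :=
      FreeGroup.lift_unique _ fun s => rfl
    rw [MonoidHom.comp_apply] at h1 h2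
    rw [h1, ← h2, PresentedGroup.one_of_mem (mem_singleton _), map_one, map_one]
  refine ⟨v, hrel, PresentedGroup.ext fun s => ?_⟩
  rw [lineRep_of, hv]

theorem tendsto_nhds_lineRep {q : ℕ} {ι : Type*} {l : Filter ι}
    {F : ι → LineRep (SurfaceGroup q)} {v : Fin q ⊕ Fin q → ℝ ≃o ℝ}
    {hv : FreeGroup.lift v (surfaceRelator q) = 1} {D : Set ℝ} (hD : Dense D)
    (h : ∀ s, ∀ x ∈ D, Tendsto (fun i => (F i (PresentedGroup.of s)).1 x) l (𝓝 (v s x))) :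
    Tendsto F l (𝓝 (lineRep v hv)) := by
  refine LineRep.tendsto_nhds_of_forall_mem (PresentedGroup.closure_range_of _) hD ?_
  rintro _ ⟨s, rfl⟩ x hx
  rw [lineRep_of]
  exact h s x hx

/-- The actions without global fixed points that are by fixed translations near `±∞`. -/
def standardReps (n : ℕ) : Set (LineRep (SurfaceGroup (n + 2))) :=
  {ρ | ∃ v hv, (∀ x, ∃ s, v s x ≠ x) ∧ (∃ L, ∀ s x, L ≤ |x| → v s x = x + standardShift n s) ∧
    lineRep v hv = ρ}

theorem mem_closure_standardReps {n : ℕ} {v : Fin (n + 2) ⊕ Fin (n + 2) → ℝ ≃o ℝ}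
    (hv : FreeGroup.lift v (surfaceRelator (n + 2)) = 1) (hfix : ∀ x, ∃ s, v s x ≠ x) :
    lineRep v hv ∈ closure (standardReps n) := by
  choose u hu huf huv huL using fun M : ℕ => exists_standard v hv hfix M
  refine mem_closure_of_tendsto (f := fun M => lineRep (u M) (hu M)) (b := atTop)
    (tendsto_nhds_lineRep dense_univ fun s x _ => ?_)
    (Eventually.of_forall fun M => ⟨u M, hu M, huf M, huL M, rfl⟩)
  refine tendsto_const_nhds.congr' ?_
  filter_upwards [eventually_ge_atTop ⌈|x|⌉₊] with M hM
  rw [lineRep_of, HomeoPlus.ofOrderIso_apply, huv M s x (Nat.ceil_le.1 hM)]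

/-- Points moved by some generator, together with interior points of the global fixed set, form a
dense set D. Approximation on finite subsets of D suffices, first by actions without global fixed
points and then by standard ones. -/
theorem dense_standardReps (n : ℕ) : Dense (standardReps n) := by
  intro ρ
  obtain ⟨v, hv, rfl⟩ := exists_lineRep_eq ρ
  obtain ⟨D, hDdef⟩ : ∃ D : Set ℝ,
    D = {x | (∃ s, v s x ≠ x) ∨ ∀ᶠ y in 𝓝 x, ∀ s, v s y = y} := ⟨_, rfl⟩
  have hDmem : ∀ x ∈ D, (∃ s, v s x ≠ x) ∨ ∀ᶠ y in 𝓝 x, ∀ s, v s y = y := by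
    rw [hDdef]; exact fun x hx => hx
  have hD : Dense D := by
    intro x
    rw [mem_closure_iff_nhds]
    intro U hU
    by_cases h : ∀ᶠ y in 𝓝 x, ∀ s, v s y = y
    · exact ⟨x, mem_of_mem_nhds hU, by rw [hDdef]; exact Or.inr h⟩
    · obtain ⟨y, hy, hyU⟩ := ((not_eventually.1 h).and_eventually hU).exists
      push Not at hy
      exact ⟨y, hyU, by rw [hDdef]; exact Or.inl hy⟩
  -- The approximations form a net indexed by a finite subset of D and a precision.
  choose u hu huf huv using fun i : Finset D × ℕ =>
    exists_no_fixed_point_near hv (i.1.map (Function.Embedding.subtype _)) (by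
      intro x hx
      obtain ⟨y, -, rfl⟩ := Finset.mem_map.1 hx
      exact hDmem _ y.2) (show (0 : ℝ) < 1 / ((i.2 : ℝ) + 1) by positivity)
  rw [← closure_closure]
  refine mem_closure_of_tendsto (f := fun i => lineRep (u i) (hu i)) (b := atTop)
    (tendsto_nhds_lineRep hD fun s x hx => ?_)
    (Eventually.of_forall fun i => mem_closure_standardReps (hu i) (huf i))
  rw [tendsto_iff_dist_tendsto_zero]
  have hlim : Tendsto (fun i : Finset D × ℕ => 1 / ((i.2 : ℝ) + 1)) atTop (𝓝 0) :=
    tendsto_one_div_add_atTop_nhds_zero_nat.comp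
      (by rw [← prod_atTop_atTop_eq]; exact tendsto_snd)
  refine squeeze_zero' (Eventually.of_forall fun _ => dist_nonneg) ?_ hlim
  filter_upwards [eventually_ge_atTop (({⟨x, hx⟩} : Finset D), 0)] with i hi
  rw [lineRep_of, HomeoPlus.ofOrderIso_apply, Real.dist_eq]
  exact (huv i x (Finset.mem_map.2 ⟨⟨x, hx⟩, hi.1 (Finset.mem_singleton_self _), rfl⟩) s).le

end SurfaceGroup

theorem mainTheorem4 (q : ℕ) (hq : 2 ≤ q) :
    ∃ ρ : LineRep (SurfaceGroup q),
      LineRep.globalFix ρ = ∅ ∧ Dense (LineRep.conjClass ρ) := by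
  obtain ⟨n, rfl⟩ : ∃ n, q = n + 2 := ⟨q - 2, by lia⟩
  obtain ⟨T, hTsub, hTc, hTd⟩ := (SurfaceGroup.dense_standardReps n).exists_countable_dense_subset
  obtain ⟨σ, hσ⟩ := hTc.exists_eq_range hTd.nonempty
  have hσs : ∀ i, σ i ∈ SurfaceGroup.standardReps n := fun i => hTsub (hσ ▸ mem_range_self i)
  choose v hv hvf hvL hvσ using hσs
  -- Unpairing the block index gives each member of the dense sequence a faithful window of every
  -- integer radius.
  obtain ⟨u, t, hu, huf, hut, -⟩ := exists_concatenation (abs_standardShift_le n)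
    (surfaceRelator (n + 2)) (fun i => v i.unpair.1) (fun i => hv _) (fun i => hvf _)
    (fun i => hvL _) (fun i => i.unpair.2) (fun i => Nat.cast_nonneg _)
  refine ⟨SurfaceGroup.lineRep u hu, ?_, ?_⟩
  · refine eq_empty_of_forall_notMem fun x hx => ?_
    obtain ⟨s, hs⟩ := huf x
    have := hx (PresentedGroup.of s)
    rw [SurfaceGroup.lineRep_of] at this
    exact hs this
  · rw [← dense_closure]
    refine hTd.mono ?_
    rw [hσ]
    rintro _ ⟨i, rfl⟩
    -- Translation by -t recentres the block in which the i-th action is copied on [-M, M]; on any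
    -- given point the conjugates then agree with that action for large M.
    choose h hh using fun M : ℕ => OrderIso.exists_affine one_pos (-t (Nat.pair i M))
    rw [← hvσ i]
    refine mem_closure_of_tendsto (b := atTop)
      (f := fun M => LineRep.conj (HomeoPlus.ofOrderIso (h M)) (SurfaceGroup.lineRep u hu))
      (SurfaceGroup.tendsto_nhds_lineRep dense_univ fun s x _ => ?_)
      (Eventually.of_forall fun M => mem_range_self _)
    refine tendsto_const_nhds.congr' ?_
    filter_upwards [eventually_ge_atTop ⌈|x|⌉₊] with M hM
    have h1 : (h M)⁻¹ x = t (Nat.pair i M) + x := by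
      rw [← (h M).injective.eq_iff, RelIso.apply_inv_self, hh]; ring
    have h2 := hut (Nat.pair i M) s x (by
      rw [Nat.unpair_pair]; exact Nat.ceil_le.1 hM)
    rw [Nat.unpair_pair] at h2
    change v i s x = (HomeoPlus.ofOrderIso (h M) *
      SurfaceGroup.lineRep u hu (PresentedGroup.of s) * (HomeoPlus.ofOrderIso (h M))⁻¹).1 x
    rw [SurfaceGroup.lineRep_of, ← map_inv, ← map_mul, ← map_mul, HomeoPlus.ofOrderIso_apply,
      RelIso.mul_apply, RelIso.mul_apply, h1, h2, hh]
    ring
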